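/- Fix a finite alphabet $\Sigma$ and an injective encoding of $\Sigma$ by the integers $0,\dots,|\Sigma|-1$ (a symbol is identified with its code). Let $\mathbb X$ be a finite nonempty linearly ordered set of string variables, and let - $\mathcal R'$ be a conjunction of memberships $x\in L(A_x)$, one for each $x\in\mathbb X$, where $A_x$ is a nondeterministic finite automaton (NFA) over $\Sigma$, the state sets being pairwise disjoint; $|\mathcal R'|$ is the total number of states of all $A_x$; - $\mathcal I$ be a conjunction of finitely many inequalities $t\le u$ between linear terms over integer variables (with no string lengths); - $L_D\ne R_D$, $1\le D\le n$, be disequalities between finite concatenations of variables of $\mathbb X$ (repetitions allowed); $m$ is the maximal number of variable occurrences in any $L_D$ or $R_D$. **Tag automaton.** A tag automaton is an NFA whose transitions $q\xrightarrow{\,Z\,}r$ carry finite sets $Z$ of tags. Replace every transition $q\xrightarrow{a}r$ of $A_x$ by $q\xrightarrow{\{S_a,\,\mathsf L_x\}}r$, and let $A_\circ$ (states $Q_\circ$) be the concatenation of these automata for all $x\in\mathbb X$ in the order of the variables: consecutive automata are joined by transitions with the empty tag set from the final states of the first to the initial states of the second; the initial states are those of the first automaton and the final states those of the last. The automaton $A$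 has states $(q,i)$ with $q\in Q_\circ$, $1\le i\le 2n+1$; initial states $(q,1)$ with $q$ initial in $A_\circ$; final states $(q,i)$ with $q$ final in $A_\circ$ and $i$ odd; and, for all disequalities $D$ and sides $s\in\{\mathsf l,\mathsf r\}$, the transitions - $(q,i)\xrightarrow{\{S_a,\mathsf L_z,\mathsf P_{i,z}\}}(r,i)$ for $1\le i\le 2n+1$, and $(q,i)\xrightarrow{\{S_a,\,\mathsf M_{i,z,D,s,a},\,\mathsf L_z,\,\mathsf P_{i+1,z}\}}(r,i+1)$ for $1\le i\le 2n$, whenever $q\xrightarrow{\{S_a,\mathsf L_z\}}r$ in $A_\circ$; - $(q,i)\xrightarrow{\emptyset}(r,i)$ for $1\le i\le 2n+1$, whenever $q\xrightarrow{\emptyset}r$ in $A_\circ$; - $(q,i)\xrightarrow{\{\mathsf C_{i,x,D,s}\}}(q,i+1)$ for $2\le i\le 2n$, $q\in Q_\circ$, $x\in\mathbb X$. The tag set consists of all $S_a$, $\mathsf L_x$, $\mathsf M_{i,x,D,s,a}$ and $\mathsf C_{i,x,D,s}$ ($1\le i\le 2n$), and $\mathsf P_{i,x}$ ($1\le i\le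 2n+1$). **Formula.** All formulas below are quantifier-free formulas of linear integer arithmetic (LIA); all variables are integer-valued, and satisfiable means having an integer model. Let $Q,\Delta,I,F$ be the states, transitions, initial and final states of $A$. The Parikh tag formula $PF_{tag}(A)$, with variables $\iota_q,f_q,\sigma_q$ ($q\in Q$), $\#t$ ($t\in\Delta$) and $\#\tau$ ($\tau$ a tag), is the conjunction of - $\#t\ge 0$ for $t\in\Delta$; $0\le\iota_q\le1$ for $q\in I$, $\iota_q=0$ for $q\notin I$, $\sum_{q\in I}\iota_q=1$; $0\le f_q\le1$ for $q\in F$, $f_q=0$ for $q\notin F$; - for every $q\in Q$: $\iota_q+\sum_{t\text{ into }q}\#t=f_q+\sum_{t\text{ out of }q}\#t$; - for every $q\in Q$: $\sigma_q=0\leftrightarrow\iota_q=1$; $\ \sigma_q\le-1\to(\iota_q=0\wedge\bigwedge_{t\text{ into }q}\#t=0)$; $\ \sigma_q>0\to\bigvee_{t=(q',Z,q)\in\Delta}(\#t>0\wedge\sigma_{q'}\ge0\wedge\sigma_q=\sigma_{q'}+1)$; - for every tag $\tau$: $\#\tau=\sum\{\#t: t=(q,Z,r)\in\Delta,\ \tau\in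 Z\}$. Further integer variables are $m_{D,s}$, $c_i$ ($0\le i\le 2n$) and $p_{D,s}$. Write $\mu_{i,x,D,s}=\sum_{a\in\Sigma}\#\mathsf M_{i,x,D,s,a}$. Define - $\varphi_{Fair}$: for all $D,s$: $\sum_{1\le i\le 2n,\ x\in\mathbb X}(\mu_{i,x,D,s}+\#\mathsf C_{i,x,D,s})\le1$; - $\varphi_{Consist}$: for all $D,s$, $a\in\Sigma$, $1\le i\le 2n$: $\big(\sum_x\#\mathsf M_{i,x,D,s,a}=1\big)\to c_i=m_{D,s}=a$, and $\big(\sum_x\#\mathsf C_{i,x,D,s}=1\big)\to c_i=m_{D,s}=c_{i-1}$; - $\varphi_{Copies}$: for all $x$ and $1\le i<2n$: $\sum_{D,s}\mu_{i,x,D,s}+\sum_{D,s}\#\mathsf C_{i,x,D,s}=0\ \to\ \sum_{D,s}\#\mathsf C_{i+1,x,D,s}=0$; and for all $x$ and $2\le i\le 2n$: $\sum_{D,s}\#\mathsf C_{i,x,D,s}=1\ \to\ \#\mathsf P_{i,x}-\sum_{D,s}\mu_{i-1,x,D,s}=0$. For $D$ with $L_D=x_1\cdots x_N$ and $R_D=y_1\cdots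 y_M$ let - $\varphi^D_{Len}$: $\sum_{i=1}^N\#\mathsf L_{x_i}\ne\sum_{j=1}^M\#\mathsf L_{y_j}$; $\qquad\varphi^D_{Sym}$: $m_{D,\mathsf l}\ne m_{D,\mathsf r}$; - $\varphi^D_{Pos}(s,v)$: for $1\le l\le 2n$: $\mu_{l,v,D,s}>0\to p_{D,s}=\sum_{k=1}^{l}\#\mathsf P_{k,v}$; and for $2\le l\le 2n$: $\#\mathsf C_{l,v,D,s}>0\to p_{D,s}=\big(\sum_{k=1}^{l}\#\mathsf P_{k,v}\big)-1$; - $\varphi^D_{Align}(i,j)$: $\sum_{l<i}\#\mathsf L_{x_l}+p_{D,\mathsf l}=\sum_{l<j}\#\mathsf L_{y_l}+p_{D,\mathsf r}$; - $\varphi^D_{\exists}(s,v)$: $\mu_{1,v,D,s}+\sum_{2\le l\le 2n}(\mu_{l,v,D,s}+\#\mathsf C_{l,v,D,s})>0$; - $\varphi^D_{Mis}=\bigvee_{1\le i\le N,\,1\le j\le M}\big(\varphi^D_{Pos}(\mathsf l,x_i)\wedge\varphi^D_{Pos}(\mathsf r,y_j)\wedge\varphi^D_{Align}(i,j)\wedge\varphi^D_{\exists}(\mathsf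 l,x_i)\wedge\varphi^D_{\exists}(\mathsf r,y_j)\big)$. Finally $$\varphi^{MultiDiseq}=PF_{tag}(A)\wedge\varphi_{Fair}\wedge\varphi_{Consist}\wedge\varphi_{Copies}\wedge\bigwedge_{D}\big(\varphi^D_{Len}\vee(\varphi^D_{Mis}\wedge\varphi^D_{Sym})\big),$$ whose variables are disjoint from those of $\mathcal I$. The size of a formula is its number of symbols, integer constants being written in binary. **Theorem.** The string constraint $\mathcal R'\wedge\mathcal I\wedge\bigwedge_{1\le D\le n}L_D\ne R_D$ is satisfiable (by an assignment of words over $\Sigma$ to the string variables and of integers to the integer variables) if and only if the LIA formula $\mathcal I\wedge\varphi^{MultiDiseq}$ is satisfiable. Moreover, there is a polynomial $P$, depending only on $\Sigma$, such that the size of $\varphi^{MultiDiseq}$ is at most $P(mn\cdot|\mathcal R'|)$ whenever $n\ge1$, $m\ge1$ and every $A_x$ has at least one state. -/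

import Mathlib

universe uA uX uQ uI

/-! Linear integer arithmetic: terms, quantifier-free formulas, semantics, size. -/

/-- Linear terms over integer variables from `V`. -/
inductive LTerm (V : Type*) where
  | var (v : V)
  | const (k : ℤ)
  | add (t u : LTerm V)
  | sub (t u : LTerm V)

namespace LTerm

/-- The value of a term under an integer assignment. -/
def eval {V : Type*} (σ : V → ℤ) : LTerm V → ℤ
  | var v => σ v
  | const k => k
  | add t u => eval σ t + eval σ u
  | sub t u => eval σ t - eval σ u

/-- Renaming of variables. -/
def rename {V W : Type*} (f : V → W) : LTerm V → LTerm W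
  | var v => var (f v)
  | const k => const k
  | add t u => add (rename f t) (rename f u)
  | sub t u => sub (rename f t) (rename f u)

/-- Number of symbols; an integer constant is charged its binary length. -/
def size {V : Type*} : LTerm V → ℕ
  | var _ => 1
  | const k => 1 + Nat.size k.natAbs
  | add t u => 1 + size t + size u
  | sub t u => 1 + size t + size u

/-- The sum of a list of terms. -/
def listSum {V : Type*} (l : List (LTerm V)) : LTerm V :=
  l.foldr add (const 0)

/-- The term `∑ i ∈ s, f i`. -/
noncomputable def sum {V ι : Type*} (s : Finset ι) (f : ι → LTerm V) : LTerm V :=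
  listSum (s.toList.map f)

end LTerm

/-- Quantifier-free formulas of linear integer arithmetic over variables from `V`. -/
inductive LIA (V : Type*) where
  | tt
  | ff
  | le (t u : LTerm V)
  | eq (t u : LTerm V)
  | not (φ : LIA V)
  | and (φ ψ : LIA V)
  | or (φ ψ : LIA V)
  | imp (φ ψ : LIA V)

namespace LIA

/-- `σ` is a model of the formula. -/
def Holds {V : Type*} (σ : V → ℤ) : LIA V → Prop
  | tt => True
  | ff => False
  | le t u => t.eval σ ≤ u.eval σ
  | eq t u => t.eval σ = u.eval σ
  | not φ => ¬ Holds σ φ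
  | and φ ψ => Holds σ φ ∧ Holds σ ψ
  | or φ ψ => Holds σ φ ∨ Holds σ ψ
  | imp φ ψ => Holds σ φ → Holds σ ψ

/-- The formula has an integer model. -/
def Satisfiable {V : Type*} (φ : LIA V) : Prop :=
  ∃ σ : V → ℤ, φ.Holds σ

/-- Renaming of variables. -/
def rename {V W : Type*} (f : V → W) : LIA V → LIA W
  | tt => tt
  | ff => ff
  | le t u => le (t.rename f) (u.rename f)
  | eq t u => eq (t.rename f) (u.rename f)
  | not φ => not (rename f φ)
  | and φ ψ => and (rename f φ) (rename f ψ)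
  | or φ ψ => or (rename f φ) (rename f ψ)
  | imp φ ψ => imp (rename f φ) (rename f ψ)

/-- Number of symbols of the formula, written out as a tree. -/
def size {V : Type*} : LIA V → ℕ
  | tt => 1
  | ff => 1
  | le t u => 1 + t.size + u.size
  | eq t u => 1 + t.size + u.size
  | not φ => 1 + size φ
  | and φ ψ => 1 + size φ + size ψ
  | or φ ψ => 1 + size φ + size ψ
  | imp φ ψ => 1 + size φ + size ψ

/-- `t < u`. -/
def lt {V : Type*} (t u : LTerm V) : LIA V := not (le u t)

/-- `t ≠ u`. -/
def ne {V : Type*} (t u : LTerm V) : LIA V := not (eq t u)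

/-- `φ ↔ ψ`. -/
def iff {V : Type*} (φ ψ : LIA V) : LIA V := and (imp φ ψ) (imp ψ φ)

/-- Conjunction of a list of formulas. -/
def listConj {V : Type*} (l : List (LIA V)) : LIA V := l.foldr and tt

/-- Disjunction of a list of formulas. -/
def listDisj {V : Type*} (l : List (LIA V)) : LIA V := l.foldr or ff

/-- The formula `⋀ i ∈ s, f i`. -/
noncomputable def conj {V ι : Type*} (s : Finset ι) (f : ι → LIA V) : LIA V :=
  listConj (s.toList.map f)

/-- The formula `⋁ i ∈ s, f i`. -/
noncomputable def disj {V ι : Type*} (s : Finset ι) (f : ι → LIA V) : LIA V :=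
  listDisj (s.toList.map f)

end LIA

/-! String constraints: regular memberships, integer constraints, disequalities. -/

/-- A conjunction of one regular membership `x ∈ L(nfa x)` for every string variable `x : X`,
of finitely many inequalities `t ≤ u` between linear terms over the integer variables `I`, and
of `n` disequalities `lhs D ≠ rhs D` between concatenations of string variables. -/
structure DiseqConstraint (A : Type uA) (X : Type uX) (Q : X → Type uQ) (I : Type uI)
    (n : ℕ) where
  nfa : (x : X) → NFA A (Q x)
  ints : List (LTerm I × LTerm I)
  lhs : Fin n → List X
  rhs : Fin n → List X

namespace DiseqConstraint

/-- The word denoted by a concatenation of variables. -/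
def word {A : Type uA} {X : Type uX} (w : X → List A) (l : List X) : List A :=
  (l.map w).flatten

/-- Some assignment of words and integers satisfies all the conjuncts. -/
def Satisfiable {A : Type uA} {X : Type uX} {Q : X → Type uQ} {I : Type uI} {n : ℕ}
    (C : DiseqConstraint A X Q I n) : Prop :=
  ∃ (w : X → List A) (v : I → ℤ),
    (∀ x, w x ∈ (C.nfa x).accepts) ∧
    (∀ c ∈ C.ints, c.1.eval v ≤ c.2.eval v) ∧
    (∀ D, word w (C.lhs D) ≠ word w (C.rhs D))

/-- The integer part as a formula. -/
def intFormula {A : Type uA} {X : Type uX} {Q : X → Type uQ} {I : Type uI} {n : ℕ}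
    (C : DiseqConstraint A X Q I n) : LIA I :=
  LIA.listConj (C.ints.map fun c => LIA.le c.1 c.2)

/-- Maximal number of variable occurrences in a side of a disequality. -/
def maxSide {A : Type uA} {X : Type uX} {Q : X → Type uQ} {I : Type uI} {n : ℕ}
    (C : DiseqConstraint A X Q I n) : ℕ :=
  Finset.univ.sup fun D => max (C.lhs D).length (C.rhs D).length

/-- Size of the regular part: the total number of states of the automata. -/
def regSize {A : Type uA} {X : Type uX} {Q : X → Type uQ} {I : Type uI} {n : ℕ}
    [Fintype X] [∀ x, Fintype (Q x)] (_C : DiseqConstraint A X Q I n) : ℕ :=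
  ∑ x, Fintype.card (Q x)

end DiseqConstraint

/-! Tag automata and their Parikh formulas. -/

/-- A tag automaton: transitions carry finite sets of tags. -/
structure TagAut (T S : Type*) where
  states : Finset S
  trans : Finset (S × Finset T × S)
  start : Finset S
  accept : Finset S

/-- The variables of the Parikh tag formula of a tag automaton: for every state `q`, indicators
that `q` is the first resp. last state of the run and the depth of `q` in a spanning tree of the
run; for every transition and every tag, its number of occurrences. -/
inductive PVar (T S : Type*) where
  | init (q : S)
  | final (q : S)
  | span (q : S)
  | trans (t : S × Finset T × S)
  | tag (t : T)

namespace TagAut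

noncomputable section

open scoped Classical

variable {T S : Type*}

/-- The `ε`-concatenation of two tag automata (over disjoint sets of states). -/
def concatEps (M N : TagAut T S) : TagAut T S where
  states := M.states ∪ N.states
  trans := M.trans ∪ N.trans ∪ (M.accept ×ˢ N.start).image fun e => (e.1, ∅, e.2)
  start := M.start
  accept := N.accept

/-- The `ε`-concatenation of a nonempty list of tag automata. -/
def concatList : List (TagAut T S) → TagAut T S
  | [] => ⟨∅, ∅, ∅, ∅⟩
  | [M] => M
  | M :: N :: l => concatEps M (concatList (N :: l))

/-- Only initial states can be first, and exactly one state is first. -/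
def initFormula (M : TagAut T S) : LIA (PVar T S) :=
  .and (LIA.conj M.start fun q =>
      .and (.le (.const 0) (.var (.init q))) (.le (.var (.init q)) (.const 1)))
    (.and (LIA.conj (M.states \ M.start) fun q => .eq (.var (.init q)) (.const 0))
      (.eq (LTerm.sum M.start fun q => .var (.init q)) (.const 1)))

/-- Only final states can be last. -/
def finalFormula (M : TagAut T S) : LIA (PVar T S) :=
  .and (LIA.conj M.accept fun q =>
      .and (.le (.const 0) (.var (.final q))) (.le (.var (.final q)) (.const 1)))
    (LIA.conj (M.states \ M.accept) fun q => .eq (.var (.final q)) (.const 0))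

/-- Transitions entering `q`. -/
def incoming (M : TagAut T S) (q : S) : Finset (S × Finset T × S) :=
  M.trans.filter fun t => t.2.2 = q

/-- Transitions leaving `q`. -/
def outgoing (M : TagAut T S) (q : S) : Finset (S × Finset T × S) :=
  M.trans.filter fun t => t.1 = q

/-- `q` is entered as often as it is left, up to the first and the last state of the run. -/
def kirchhoffFormula (M : TagAut T S) (q : S) : LIA (PVar T S) :=
  .eq (.add (.var (.init q)) (LTerm.sum (M.incoming q) fun t => .var (.trans t)))
    (.add (.var (.final q)) (LTerm.sum (M.outgoing q) fun t => .var (.trans t)))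

/-- The transitions that are used are connected to the first state. -/
def spanFormula (M : TagAut T S) (q : S) : LIA (PVar T S) :=
  .and (LIA.iff (.eq (.var (.span q)) (.const 0)) (.eq (.var (.init q)) (.const 1)))
    (.and
      (.imp (.le (.var (.span q)) (.const (-1)))
        (.and (.eq (.var (.init q)) (.const 0))
          (LIA.conj (M.incoming q) fun t => .eq (.var (.trans t)) (.const 0))))
      (.imp (LIA.lt (.const 0) (.var (.span q)))
        (LIA.disj (M.incoming q) fun t =>
          .and (LIA.lt (.const 0) (.var (.trans t)))
            (.and (.le (.const 0) (.var (.span t.1)))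
              (.eq (.var (.span q)) (.add (.var (.span t.1)) (.const 1)))))))

/-- The Parikh formula: the values of the variables `trans t` are the numbers of occurrences of
the transitions in an accepting run. -/
def parikhFormula (M : TagAut T S) : LIA (PVar T S) :=
  .and (LIA.conj M.trans fun t => .le (.const 0) (.var (.trans t)))
    (.and M.initFormula
      (.and M.finalFormula
        (LIA.conj M.states fun q => .and (M.kirchhoffFormula q) (M.spanFormula q))))

/-- The Parikh tag formula for the tags in `tags`: moreover, the values of the variables `tag t`
are the numbers of occurrences of the tags. -/
def parikhTagFormula (M : TagAut T S) (tags : Finset T) : LIA (PVar T S) :=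
  .and M.parikhFormula
    (LIA.conj tags fun t =>
      .eq (.var (.tag t))
        (LTerm.sum (M.trans.filter fun d => t ∈ d.2.1) fun d => .var (.trans d)))

end

end TagAut

/-! The tag automaton of a system of disequalities. -/

/-- The left and the right side of a disequality. -/
inductive Side where
  | left
  | right
deriving DecidableEq

instance Side.instFintype : Fintype Side :=
  ⟨{Side.left, Side.right}, fun s => by cases s <;> simp⟩

/-- The tags for a system of `n` disequalities. -/
inductive Tag (A : Type uA) (X : Type uX) (n : ℕ) where
  /-- the symbol `a` is read -/
  | sym (a : A)
  /-- a symbol of the value of `x` is read -/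
  | len (x : X)
  /-- the `i`-th sampled symbol is an `a` in `x`, sampled for side `s` of disequality `D` -/
  | mis (i : ℕ) (x : X) (D : Fin n) (s : Side) (a : A)
  /-- as its `i`-th symbol, the run reuses for side `s` of `D` the symbol last sampled, in `x` -/
  | cop (i : ℕ) (x : X) (D : Fin n) (s : Side)
  /-- a symbol of the value of `x` is counted on level `i` -/
  | pos (i : ℕ) (x : X)

/-- The variables of the formula for a system of disequalities. -/
inductive MVar (A : Type uA) (X : Type uX) (S : Type*) (n : ℕ) where
  | parikh (v : PVar (Tag A X n) S)
  /-- the mismatch symbol for side `s` of `D` -/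
  | misSym (D : Fin n) (s : Side)
  /-- the `i`-th mismatch symbol -/
  | shared (i : ℕ)
  /-- the position, inside its variable, of the mismatch symbol for side `s` of `D` -/
  | misPos (D : Fin n) (s : Side)

namespace MultiDiseq

noncomputable section

open scoped Classical

variable {A : Type uA} {X : Type uX} {Q : X → Type uQ} {I : Type uI} {n : ℕ}

section Automaton

variable [Fintype A] [Fintype X] [∀ x, Fintype (Q x)]

/-- The automaton of the variable `x`, each transition on `a` being tagged by `sym a` and `len x`.
States of automata of different variables are kept apart by the dependent sum. -/
def lenTagAut (n : ℕ) (x : X) (M : NFA A (Q x)) : TagAut (Tag A X n) (Σ x, Q x) where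
  states := Finset.univ.image fun q : Q x => ⟨x, q⟩
  trans := (Finset.univ.filter fun t : Q x × A × Q x => t.2.2 ∈ M.step t.1 t.2.1).image
    fun t => (⟨x, t.1⟩, {Tag.sym t.2.1, Tag.len x}, ⟨x, t.2.2⟩)
  start := (Finset.univ.filter fun q => q ∈ M.start).image fun q : Q x => ⟨x, q⟩
  accept := (Finset.univ.filter fun q => q ∈ M.accept).image fun q : Q x => ⟨x, q⟩

/-- The `ε`-concatenation of the automata of all variables, in the order of the variables. -/
def conAut [LinearOrder X] (C : DiseqConstraint A X Q I n) :
    TagAut (Tag A X n) (Σ x, Q x) :=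
  TagAut.concatList
    (((Finset.univ : Finset X).sort (· ≤ ·)).map fun x => lenTagAut n x (C.nfa x))

/-- The set of all tags. -/
def allTags (A : Type uA) (X : Type uX) (n : ℕ) [Fintype A] [Fintype X] : Finset (Tag A X n) :=
  (Finset.univ.image fun a : A => Tag.sym a) ∪
  (Finset.univ.image fun x : X => Tag.len x) ∪
  ((Finset.Icc 1 (2 * n) ×ˢ (Finset.univ : Finset (X × Fin n × Side × A))).image
    fun e => Tag.mis e.1 e.2.1 e.2.2.1 e.2.2.2.1 e.2.2.2.2) ∪
  ((Finset.Icc 1 (2 * n) ×ˢ (Finset.univ : Finset (X × Fin n × Side))).image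
    fun e => Tag.cop e.1 e.2.1 e.2.2.1 e.2.2.2) ∪
  ((Finset.Icc 1 (2 * n + 1) ×ˢ (Finset.univ : Finset X)).image fun e => Tag.pos e.1 e.2)

/-- All `(q, a, z, r)` such that `M` has a transition from `q` to `r` reading `a` in `z`. -/
def readMoves (M : TagAut (Tag A X n) (Σ x, Q x)) :
    Finset ((Σ x, Q x) × A × X × (Σ x, Q x)) :=
  Finset.univ.filter fun e => (e.1, {Tag.sym e.2.1, Tag.len e.2.2.1}, e.2.2.2) ∈ M.trans

/-- All `(q, r)` such that `M` has an untagged transition from `q` to `r`. -/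
def epsMoves (M : TagAut (Tag A X n) (Σ x, Q x)) : Finset ((Σ x, Q x) × (Σ x, Q x)) :=
  Finset.univ.filter fun e => (e.1, ∅, e.2) ∈ M.trans

/-- The tag automaton of the system: copies `1, …, 2 n + 1` of the `ε`-concatenation, connected
by mismatch and copy transitions. -/
def multiAut [LinearOrder X] (C : DiseqConstraint A X Q I n) :
    TagAut (Tag A X n) ((Σ x, Q x) × ℕ) where
  states := (conAut C).states ×ˢ Finset.Icc 1 (2 * n + 1)
  start := (conAut C).start ×ˢ {1}
  accept := (conAut C).accept ×ˢ (Finset.Icc 1 (2 * n + 1)).filter fun i => Odd i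
  trans :=
    ((readMoves (conAut C) ×ˢ Finset.Icc 1 (2 * n + 1)).image fun e =>
      match e with
      | ((q, a, z, r), i) => ((q, i), {Tag.sym a, Tag.len z, Tag.pos i z}, (r, i))) ∪
    ((epsMoves (conAut C) ×ˢ Finset.Icc 1 (2 * n + 1)).image fun e =>
      match e with
      | ((q, r), i) => ((q, i), ∅, (r, i))) ∪
    ((readMoves (conAut C) ×ˢ Finset.Icc 1 (2 * n) ×ˢ
        (Finset.univ : Finset (Fin n × Side))).image fun e =>
      match e with
      | ((q, a, z, r), i, D, s) =>
        ((q, i), {Tag.sym a, Tag.mis i z D s a, Tag.len z, Tag.pos (i + 1) z}, (r, i + 1))) ∪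
    (((conAut C).states ×ˢ Finset.Icc 2 (2 * n) ×ˢ
        (Finset.univ : Finset (X × Fin n × Side))).image fun e =>
      match e with
      | (q, i, x, D, s) => ((q, i), {Tag.cop i x D s}, (q, i + 1)))

end Automaton

section Formula

variable {S : Type*}

/-- The variable counting a tag. -/
def cnt (t : Tag A X n) : LTerm (MVar A X S n) := .var (.parikh (.tag t))

/-- The variable for the mismatch symbol of side `s` of `D`. -/
def symVar (D : Fin n) (s : Side) : LTerm (MVar A X S n) := .var (.misSym D s)

/-- The variable for the `i`-th mismatch symbol. -/
def sharedVar (i : ℕ) : LTerm (MVar A X S n) := .var (.shared i)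

/-- The variable for the local mismatch position of side `s` of `D`. -/
def posVar (D : Fin n) (s : Side) : LTerm (MVar A X S n) := .var (.misPos D s)

/-- The integer encoding of a symbol. -/
def code [Fintype A] (a : A) : LTerm (MVar A X S n) := .const (Fintype.equivFin A a : ℕ)

/-- Number of `i`-th mismatches in `x` for side `s` of `D`, with any symbol. -/
def misCount [Fintype A] (i : ℕ) (x : X) (D : Fin n) (s : Side) : LTerm (MVar A X S n) :=
  LTerm.sum Finset.univ fun a : A => cnt (.mis i x D s a)

/-- Number of `i`-th mismatches in `x`, for any side of any disequality. -/
def misTotal [Fintype A] (i : ℕ) (x : X) : LTerm (MVar A X S n) :=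
  LTerm.sum (Finset.univ : Finset (Fin n × Side)) fun e => misCount i x e.1 e.2

/-- Number of `i`-th copies in `x`, for any side of any disequality. -/
def copTotal (i : ℕ) (x : X) : LTerm (MVar A X S n) :=
  LTerm.sum (Finset.univ : Finset (Fin n × Side)) fun e => cnt (.cop i x e.1 e.2)

/-- At most one mismatch or copy for each side of each disequality. -/
def fairFormula (A : Type uA) (X : Type uX) (S : Type*) (n : ℕ) [Fintype A] [Fintype X] :
    LIA (MVar A X S n) :=
  LIA.conj (Finset.univ : Finset (Fin n × Side)) fun e =>
    .le (LTerm.sum (Finset.Icc 1 (2 * n) ×ˢ (Finset.univ : Finset X)) fun d =>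
        .add (misCount d.1 d.2 e.1 e.2) (cnt (.cop d.1 d.2 e.1 e.2)))
      (.const 1)

/-- The symbol variables hold the sampled symbols. -/
def consistFormula (A : Type uA) (X : Type uX) (S : Type*) (n : ℕ) [Fintype A] [Fintype X] :
    LIA (MVar A X S n) :=
  LIA.conj ((Finset.univ : Finset (Fin n × Side × A)) ×ˢ Finset.Icc 1 (2 * n)) fun e =>
    match e with
    | ((D, s, a), i) =>
      .and
        (.imp (.eq (LTerm.sum (Finset.univ : Finset X) fun x => cnt (.mis i x D s a)) (.const 1))
          (.and (.eq (sharedVar i) (symVar D s)) (.eq (symVar D s) (code a))))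
        (.imp (.eq (LTerm.sum (Finset.univ : Finset X) fun x => cnt (.cop i x D s)) (.const 1))
          (.and (.eq (sharedVar i) (symVar D s)) (.eq (symVar D s) (sharedVar (i - 1)))))

/-- A copy for `x` follows immediately a mismatch or a copy for `x`. -/
def copiesFormula (A : Type uA) (X : Type uX) (S : Type*) (n : ℕ) [Fintype A] [Fintype X] :
    LIA (MVar A X S n) :=
  .and
    (LIA.conj (Finset.Ico 1 (2 * n) ×ˢ (Finset.univ : Finset X)) fun e =>
      .imp (.eq (.add (misTotal e.1 e.2) (copTotal e.1 e.2)) (.const 0))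
        (.eq (copTotal (e.1 + 1) e.2) (.const 0)))
    (LIA.conj (Finset.Icc 2 (2 * n) ×ˢ (Finset.univ : Finset X)) fun e =>
      .imp (.eq (copTotal e.1 e.2) (.const 1))
        (.eq (.sub (cnt (.pos e.1 e.2)) (misTotal (e.1 - 1) e.2)) (.const 0)))

/-- The length of the value of a concatenation of variables. -/
def lenTerm (l : List X) : LTerm (MVar A X S n) :=
  LTerm.listSum (l.map fun x => cnt (.len x))

/-- The two sides, `l` and `r`, have different lengths. -/
def lenFormula (l r : List X) : LIA (MVar A X S n) := LIA.ne (lenTerm l) (lenTerm r)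

/-- The number of symbols of `v` read on the levels `1, …, k`. -/
def posSum (k : ℕ) (v : X) : LTerm (MVar A X S n) :=
  LTerm.sum (Finset.Icc 1 k) fun j => cnt (.pos j v)

/-- The variable `posVar D s` holds the position in `v` of the symbol sampled for side `s` of `D`.
A mismatch transition leaving level `k` counts its own symbol on level `k + 1`, so a copy
transition leaving level `k`, which comes later, has to discount this symbol. -/
def posFormula [Fintype A] (D : Fin n) (s : Side) (v : X) : LIA (MVar A X S n) :=
  .and
    (LIA.conj (Finset.Icc 1 (2 * n)) fun k =>
      .imp (LIA.lt (.const 0) (misCount k v D s)) (.eq (posVar D s) (posSum k v)))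
    (LIA.conj (Finset.Icc 2 (2 * n)) fun k =>
      .imp (LIA.lt (.const 0) (cnt (.cop k v D s)))
        (.eq (posVar D s) (.sub (posSum k v) (.const 1))))

/-- For the prefixes `l` and `r` of the two sides of `D` that precede the mismatch variables, the
global positions of the mismatch symbols agree. -/
def alignFormula (D : Fin n) (l r : List X) : LIA (MVar A X S n) :=
  .eq (.add (lenTerm l) (posVar D .left)) (.add (lenTerm r) (posVar D .right))

/-- A symbol of `v` is sampled for side `s` of `D`. -/
def presentFormula [Fintype A] (D : Fin n) (s : Side) (v : X) : LIA (MVar A X S n) :=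
  LIA.lt (.const 0)
    (.add (misCount 1 v D s)
      (LTerm.sum (Finset.Icc 2 (2 * n)) fun k =>
        .add (misCount k v D s) (cnt (.cop k v D s))))

/-- Some occurrence of a variable in the left side `l` of `D` and some occurrence in the right
side `r` contain sampled symbols at equal global positions. -/
def misFormula [Fintype A] (D : Fin n) (l r : List X) : LIA (MVar A X S n) :=
  LIA.disj (Finset.univ : Finset (Fin l.length × Fin r.length)) fun e =>
    .and (posFormula D .left (l.get e.1))
      (.and (posFormula D .right (r.get e.2))
        (.and (alignFormula D (l.take e.1) (r.take e.2))
          (.and (presentFormula D .left (l.get e.1)) (presentFormula D .right (r.get e.2)))))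

/-- The mismatch symbols of the two sides of `D` differ. -/
def symFormula (D : Fin n) : LIA (MVar A X S n) := LIA.ne (symVar D .left) (symVar D .right)

end Formula

/-- The formula of the system of disequalities under the regular memberships. -/
def formula [Fintype A] [Fintype X] [LinearOrder X] [∀ x, Fintype (Q x)]
    (C : DiseqConstraint A X Q I n) : LIA (MVar A X ((Σ x, Q x) × ℕ) n) :=
  .and (((multiAut C).parikhTagFormula (allTags A X n)).rename MVar.parikh)
    (.and (fairFormula A X _ n)
      (.and (consistFormula A X _ n)
        (.and (copiesFormula A X _ n)
          (LIA.conj Finset.univ fun D =>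
            .or (lenFormula (C.lhs D) (C.rhs D))
              (.and (misFormula D (C.lhs D) (C.rhs D)) (symFormula D))))))

/-- The formula of the system in conjunction with the integer constraints, whose variables are
kept apart from those of the formula. -/
def fullFormula [Fintype A] [Fintype X] [LinearOrder X] [∀ x, Fintype (Q x)]
    (C : DiseqConstraint A X Q I n) : LIA (I ⊕ MVar A X ((Σ x, Q x) × ℕ) n) :=
  .and (C.intFormula.rename Sum.inl) ((formula C).rename Sum.inr)

end

end MultiDiseq

/-!
A model of the Parikh tag formula assigns multiplicities to the transitions of the automaton; the
flow equations and the spanning tree make them the multiplicities of an Eulerian walk, that is of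
an accepting run. Such a run reads one word for every string variable and carries at most `2 n`
samples of letters, one for each side of each disequality. Two words of equal length differ if and
only if they differ at some position, so two sampled letters, at the same global position in the
two sides, witness a disequality. The only obstacle is that a mismatch transition consumes its
letter, while several sides may need the same letter of the same variable: these sides are served
by copy transitions directly after the mismatch transition. Conversely, sorting the required
positions along the run places all samples, those with equal positions becoming copies.
-/

namespace LTerm

variable {V W ι : Type*}

@[simp]
theorem eval_listSum (σ : V → ℤ) (l : List (LTerm V)) :
    (listSum l).eval σ = (l.map (eval σ)).sum := by
  induction l with
  | nil => rfl
  | cons t l ih => exact congrArg (eval σ t + ·) ih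

@[simp]
theorem eval_sum (σ : V → ℤ) (s : Finset ι) (f : ι → LTerm V) :
    (sum s f).eval σ = ∑ i ∈ s, (f i).eval σ := by
  rw [sum, eval_listSum, List.map_map, ← Finset.sum_map_toList]
  rfl

@[simp]
theorem eval_rename (f : V → W) (σ : W → ℤ) (t : LTerm V) :
    (t.rename f).eval σ = t.eval (σ ∘ f) := by
  induction t with
  | var | const => rfl
  | add _ _ iht ihu | sub _ _ iht ihu => simp only [rename, eval, iht, ihu]

end LTerm

namespace LIA

variable {V W ι : Type*}

@[simp]
theorem holds_listConj (σ : V → ℤ) (l : List (LIA V)) :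
    (listConj l).Holds σ ↔ ∀ φ ∈ l, φ.Holds σ := by
  induction l with
  | nil => simp [listConj, Holds]
  | cons φ l ih =>
    rw [List.forall_mem_cons, ← ih]
    rfl

@[simp]
theorem holds_listDisj (σ : V → ℤ) (l : List (LIA V)) :
    (listDisj l).Holds σ ↔ ∃ φ ∈ l, φ.Holds σ := by
  induction l with
  | nil => simp [listDisj, Holds]
  | cons φ l ih =>
    rw [List.exists_mem_cons_iff, ← ih]
    rfl

@[simp]
theorem holds_conj (σ : V → ℤ) (s : Finset ι) (f : ι → LIA V) :
    (conj s f).Holds σ ↔ ∀ i ∈ s, (f i).Holds σ := by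
  simp [conj]

@[simp]
theorem holds_disj (σ : V → ℤ) (s : Finset ι) (f : ι → LIA V) :
    (disj s f).Holds σ ↔ ∃ i ∈ s, (f i).Holds σ := by
  simp [disj]

@[simp]
theorem holds_rename (f : V → W) (σ : W → ℤ) (φ : LIA V) :
    (φ.rename f).Holds σ ↔ φ.Holds (σ ∘ f) := by
  induction φ with
  | tt | ff => rfl
  | le | eq => simp only [rename, Holds, LTerm.eval_rename]
  | not _ ih => simp only [rename, Holds, ih]
  | and _ _ ihφ ihψ | or _ _ ihφ ihψ | imp _ _ ihφ ihψ => simp only [rename, Holds, ihφ, ihψ]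

@[simp]
theorem holds_lt (σ : V → ℤ) (t u : LTerm V) : (lt t u).Holds σ ↔ t.eval σ < u.eval σ :=
  not_le

@[simp]
theorem holds_ne (σ : V → ℤ) (t u : LTerm V) : (ne t u).Holds σ ↔ t.eval σ ≠ u.eval σ :=
  Iff.rfl

@[simp]
theorem holds_iff (σ : V → ℤ) (φ ψ : LIA V) : (iff φ ψ).Holds σ ↔ (φ.Holds σ ↔ ψ.Holds σ) :=
  iff_iff_implies_and_implies.symm

end LIA

/-! ### Walks and Euler's theorem -/

/-- The list of labelled edges `(source, label, target)` is a walk from `p` to `q`. -/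
def IsWalk {S T : Type*} : S → List (S × T × S) → S → Prop
  | p, [], q => p = q
  | p, t :: l, q => t.1 = p ∧ IsWalk t.2.2 l q

namespace IsWalk

variable {S T : Type*} {p q u v w : S} {l l₁ l₂ : List (S × T × S)} {m m' : Multiset (S × T × S)}

theorem append_iff : IsWalk p (l₁ ++ l₂) q ↔ ∃ v, IsWalk p l₁ v ∧ IsWalk v l₂ q := by
  induction l₁ generalizing p with
  | nil => exact ⟨fun h => ⟨p, rfl, h⟩, by rintro ⟨v, rfl, h⟩; exact h⟩
  | cons t l ih => simp only [List.cons_append, IsWalk, ih, and_assoc, exists_and_left]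

theorem append (h₁ : IsWalk p l₁ v) (h₂ : IsWalk v l₂ q) : IsWalk p (l₁ ++ l₂) q :=
  append_iff.2 ⟨v, h₁, h₂⟩

theorem concat_iff {t : S × T × S} : IsWalk p (l ++ [t]) q ↔ IsWalk p l t.1 ∧ t.2.2 = q := by
  rw [append_iff]
  exact ⟨by rintro ⟨v, h, rfl, h'⟩; exact ⟨h, h'⟩, fun ⟨h, h'⟩ => ⟨t.1, h, rfl, h'⟩⟩

/-- The set of vertices on a walk `l` that starts in `p`. -/
def visited (p : S) (l : List (S × T × S)) : Set S :=
  {v | v = p ∨ ∃ t ∈ l, t.2.2 = v}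

theorem start_mem_visited : p ∈ visited p l :=
  Or.inl rfl

theorem target_mem_visited {t : S × T × S} (ht : t ∈ l) : t.2.2 ∈ visited p l :=
  Or.inr ⟨t, ht, rfl⟩

theorem visited_concat {t : S × T × S} : visited p (l ++ [t]) = insert t.2.2 (visited p l) := by
  ext v
  simp only [visited, List.mem_append, List.mem_singleton, or_and_right, exists_or,
    exists_eq_left, Set.mem_ofPred_eq, Set.mem_insert_iff, eq_comm (a := t.2.2)]
  rw [← or_assoc, or_comm]

theorem exists_split_of_mem_visited (h : IsWalk p l q) (hv : v ∈ visited p l) :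
    ∃ l₁ l₂, l = l₁ ++ l₂ ∧ IsWalk p l₁ v ∧ IsWalk v l₂ q := by
  rcases hv with rfl | ⟨t, ht, rfl⟩
  · exact ⟨[], l, rfl, rfl, h⟩
  · obtain ⟨l₁, l₂, rfl⟩ := List.append_of_mem ht
    obtain ⟨v, h₁, rfl, h₂⟩ := append_iff.1 h
    exact ⟨l₁ ++ [t], l₂, by simp, concat_iff.2 ⟨h₁, rfl⟩, h₂⟩

theorem end_mem_visited (h : IsWalk p l q) : q ∈ visited p l := by
  rcases List.eq_nil_or_concat' l with rfl | ⟨l, t, rfl⟩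
  · exact Or.inl h.symm
  · obtain ⟨-, rfl⟩ := concat_iff.1 h
    exact target_mem_visited (by simp)

theorem exists_edge_leaving {V : Set S} (h : IsWalk u l w) (hu : u ∈ V) (hw : w ∉ V) :
    ∃ t ∈ l, t.1 ∈ V ∧ t.2.2 ∉ V := by
  induction l generalizing u with
  | nil => cases h; exact absurd hu hw
  | cons t l ih =>
    obtain ⟨rfl, h⟩ := h
    by_cases ht : t.2.2 ∈ V
    · obtain ⟨s, hs, hs'⟩ := ih h ht
      exact ⟨s, List.mem_cons_of_mem _ hs, hs'⟩
    · exact ⟨t, List.mem_cons_self, hu, ht⟩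

/-- `d v` is the depth of `v` in a spanning tree of the walk, and negative off the walk. -/
theorem exists_spanning_depth (h : IsWalk p l q) :
    ∃ d : S → ℤ, (∀ v, d v = 0 ↔ v = p) ∧ (∀ v, 0 ≤ d v ↔ v ∈ visited p l) ∧
      ∀ v, 0 < d v → ∃ t ∈ l, t.2.2 = v ∧ 0 ≤ d t.1 ∧ d v = d t.1 + 1 := by
  classical
  induction l using List.reverseRecOn generalizing q with
  | nil =>
    refine ⟨fun v => if v = p then 0 else -1, fun v => ?_, fun v => ?_, fun v => ?_⟩ <;>
      by_cases hv : v = p <;> simp [hv, visited]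
  | append_singleton l t ih =>
    obtain ⟨hl, rfl⟩ := concat_iff.1 h
    obtain ⟨d, hd₀, hd₁, hd₂⟩ := ih hl
    have hsrc : 0 ≤ d t.1 := (hd₁ _).2 hl.end_mem_visited
    by_cases ht : 0 ≤ d t.2.2
    · refine ⟨d, hd₀, fun v => ?_, fun v hv => ?_⟩
      · rw [visited_concat, Set.insert_eq_of_mem ((hd₁ _).1 ht), hd₁]
      · obtain ⟨s, hs, h⟩ := hd₂ v hv
        exact ⟨s, List.mem_append_left _ hs, h⟩
    have hloop : t.1 ≠ t.2.2 := fun he => ht (he ▸ hsrc)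
    refine ⟨Function.update d t.2.2 (d t.1 + 1), fun v => ?_, fun v => ?_, fun v => ?_⟩ <;>
      by_cases hv : v = t.2.2
    · have hne : t.2.2 ≠ p := fun he => ht ((hd₀ _).2 he).ge
      simp only [hv, Function.update_self, hne, iff_false]
      lia
    · rw [Function.update_of_ne hv, hd₀]
    · simpa [hv, visited_concat] using by lia
    · rw [Function.update_of_ne hv, hd₁, visited_concat, Set.mem_insert_iff, or_iff_right hv]
    · exact fun _ => ⟨t, by simp, hv.symm, by simp [hloop, hsrc], by simp [hv, hloop]⟩
    · rw [Function.update_of_ne hv]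
      intro hpos
      obtain ⟨s, hs, rfl, hs₀, hs₁⟩ := hd₂ v hpos
      have hne : s.1 ≠ t.2.2 := fun he => ht (he ▸ hs₀)
      exact ⟨s, List.mem_append_left _ hs, rfl, by simp [hne, hs₀], by simp [hne, hs₁]⟩

section Balanced

variable [DecidableEq S]

/-- The edges of `m` enter and leave every vertex equally often, up to one extra start at `p`
and one extra end at `q`. -/
def Balanced (m : Multiset (S × T × S)) (p q : S) : Prop :=
  ∀ v, (if v = p then 1 else 0) + m.countP (fun t => t.2.2 = v) =
    (if v = q then 1 else 0) + m.countP (fun t => t.1 = v)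

theorem balanced (h : IsWalk p l q) : Balanced (l : Multiset (S × T × S)) p q := by
  induction l generalizing p with
  | nil => cases h; exact fun _ => rfl
  | cons t l ih =>
    obtain ⟨rfl, h⟩ := h
    intro v
    have := ih h v
    simp only [← Multiset.cons_coe, Multiset.countP_cons, eq_comm (a := v)] at this ⊢
    lia

theorem Balanced.of_cons {t : S × T × S} (h : Balanced (t ::ₘ m) t.1 q) :
    Balanced m t.2.2 q := by
  intro v
  have := h v
  simp only [Multiset.countP_cons, eq_comm (a := v)] at this ⊢
  lia

theorem Balanced.sub [DecidableEq T] (h : Balanced m p q) (h' : Balanced m' p q) (hle : m' ≤ m) :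
    Balanced (m - m') v v := by
  intro w
  rw [Multiset.countP_sub hle, Multiset.countP_sub hle]
  have := h w
  have := h' w
  have := Multiset.countP_le_of_le (fun t => t.1 = w) hle
  have := Multiset.countP_le_of_le (fun t => t.2.2 = w) hle
  lia

theorem Balanced.eq_of_forall_source_ne (h : Balanced m p q) (hp : ∀ t ∈ m, t.1 ≠ p) : p = q := by
  by_contra hne
  have := h p
  rw [if_pos rfl, if_neg hne, Multiset.countP_eq_zero.2 hp] at this
  lia

theorem Balanced.exists_walk_le (h : Balanced m p q) :
    ∃ l : List (S × T × S), IsWalk p l q ∧ (l : Multiset (S × T × S)) ≤ m ∧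
      ((∃ t ∈ m, t.1 = p) → l ≠ []) := by
  induction m using Multiset.strongInductionOn generalizing p with
  | ih m ih =>
    by_cases he : ∃ t ∈ m, t.1 = p
    · obtain ⟨t, ht, rfl⟩ := he
      obtain ⟨m', rfl⟩ := Multiset.exists_cons_of_mem ht
      obtain ⟨l, hl, hle, -⟩ := ih m' (Multiset.lt_cons_self _ _) h.of_cons
      exact ⟨t :: l, ⟨rfl, hl⟩, Multiset.cons_le_cons t hle, by simp⟩
    · exact ⟨[], h.eq_of_forall_source_ne (fun t ht hp => he ⟨t, ht, hp⟩), by simp,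
        fun h' => absurd h' he⟩

theorem exists_unused_edge [DecidableEq T] (hlt : (l : Multiset (S × T × S)) < m)
    (hconn : ∀ t ∈ m, ∃ k, IsWalk p k t.1 ∧ ∀ s ∈ k, s ∈ m) :
    ∃ t ∈ m - (l : Multiset (S × T × S)), t.1 ∈ visited p l := by
  obtain ⟨e, he⟩ := Multiset.exists_mem_of_ne_zero fun h => hlt.not_ge (tsub_eq_zero_iff_le.1 h)
  by_cases hev : e.1 ∈ visited p l
  · exact ⟨e, he, hev⟩
  obtain ⟨k, hk, hkm⟩ := hconn e (Multiset.mem_of_le tsub_le_self he)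
  obtain ⟨t, ht, hsrc, htgt⟩ := hk.exists_edge_leaving start_mem_visited hev
  have htl : t ∉ l := fun h => htgt (target_mem_visited h)
  refine ⟨t, ?_, hsrc⟩
  rw [Multiset.mem_sub, Multiset.count_eq_zero_of_notMem (by simpa using htl)]
  exact Multiset.count_pos.2 (hkm t ht)

theorem exists_longer_walk (h : Balanced m p q)
    (hconn : ∀ t ∈ m, ∃ k, IsWalk p k t.1 ∧ ∀ s ∈ k, s ∈ m)
    (hl : IsWalk p l q) (hlt : (l : Multiset (S × T × S)) < m) :
    ∃ l' : List (S × T × S), IsWalk p l' q ∧ (l' : Multiset (S × T × S)) ≤ m ∧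
      l.length < l'.length := by
  classical
  obtain ⟨t, ht, htv⟩ := exists_unused_edge hlt hconn
  obtain ⟨l₁, l₂, rfl, h₁, h₂⟩ := hl.exists_split_of_mem_visited htv
  obtain ⟨k, hk, hkle, hne⟩ := (h.sub hl.balanced hlt.le (v := t.1)).exists_walk_le
  refine ⟨l₁ ++ (k ++ l₂), h₁.append (hk.append h₂), ?_, ?_⟩
  · refine le_of_eq_of_le ?_ ((le_tsub_iff_left hlt.le).1 hkle)
    simp only [← Multiset.coe_add]
    abel
  · have := List.length_pos_iff.2 (hne ⟨t, ht, rfl⟩)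
    simp only [List.length_append]
    lia

theorem exists_eulerian (h : Balanced m p q)
    (hconn : ∀ t ∈ m, ∃ k, IsWalk p k t.1 ∧ ∀ s ∈ k, s ∈ m) :
    ∃ l : List (S × T × S), IsWalk p l q ∧ (l : Multiset (S × T × S)) = m := by
  by_contra! hne
  have long : ∀ N, ∃ l : List (S × T × S),
      IsWalk p l q ∧ (l : Multiset (S × T × S)) ≤ m ∧ N ≤ l.length := by
    intro N
    induction N with
    | zero =>
      obtain ⟨l, hl, hle, -⟩ := h.exists_walk_le
      exact ⟨l, hl, hle, Nat.zero_le _⟩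
    | succ N ih =>
      obtain ⟨l, hl, hle, hN⟩ := ih
      obtain ⟨l', hl', hle', hlen⟩ :=
        exists_longer_walk h hconn hl (lt_of_le_of_ne hle (hne l hl))
      exact ⟨l', hl', hle', by lia⟩
  obtain ⟨l, -, hle, hlen⟩ := long (m.card + 1)
  have := Multiset.card_le_card hle
  rw [Multiset.coe_card] at this
  lia

end Balanced

end IsWalk

/-! ### Correctness of the Parikh tag formula -/

theorem countP_sum_replicate {α : Type*} (s : Finset α) (f : α → ℕ) (P : α → Prop)
    [DecidablePred P] :
    (∑ a ∈ s, Multiset.replicate (f a) a).countP P = ∑ a ∈ s with P a, f a := by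
  rw [← Multiset.coe_countPAddMonoidHom, map_sum, Finset.sum_filter]
  refine Finset.sum_congr rfl fun a _ => ?_
  rw [Multiset.coe_countPAddMonoidHom, ← Multiset.coe_replicate, Multiset.coe_countP,
    List.countP_replicate]
  simp

theorem mem_sum_replicate {α : Type*} {s : Finset α} {f : α → ℕ} {a : α} :
    a ∈ ∑ b ∈ s, Multiset.replicate (f b) b ↔ a ∈ s ∧ 0 < f a := by
  simp only [Multiset.mem_sum, Multiset.mem_replicate, Nat.pos_iff_ne_zero]
  exact ⟨by rintro ⟨b, hb, hf, rfl⟩; exact ⟨hb, hf⟩, fun ⟨ha, hf⟩ => ⟨a, ha, hf, rfl⟩⟩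

theorem sum_count_filter_eq_countP {α : Type*} [BEq α] [LawfulBEq α] {s : Finset α} {l : List α}
    (hl : ∀ a ∈ l, a ∈ s) (P : α → Prop) [DecidablePred P] :
    ∑ a ∈ s with P a, l.count a = l.countP (fun a => P a) := by
  classical
  induction l with
  | nil => simp
  | cons a l ih =>
    simp only [List.count_cons, List.countP_cons, Finset.sum_add_distrib, beq_iff_eq,
      Finset.sum_ite_eq, Finset.mem_filter, hl a List.mem_cons_self, true_and,
      decide_eq_true_eq, ih fun b hb => hl b (List.mem_cons_of_mem _ hb)]

theorem exists_eq_ite_of_sum_eq_one {ι : Type*} [DecidableEq ι] {s t : Finset ι} {f : ι → ℤ}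
    (hnonneg : ∀ i ∈ s, 0 ≤ f i) (hsum : ∑ i ∈ s, f i = 1)
    (hzero : ∀ i ∈ t, i ∉ s → f i = 0) :
    ∃ i ∈ s, ∀ j ∈ t, f j = if j = i then 1 else 0 := by
  obtain ⟨i, hi, hne⟩ := Finset.exists_ne_zero_of_sum_ne_zero (hsum ▸ one_ne_zero)
  have hrest : ∀ j ∈ s.erase i, 0 ≤ f j := fun j hj => hnonneg j (Finset.mem_of_mem_erase hj)
  have hi₀ := hnonneg i hi
  have hadd := Finset.add_sum_erase s f hi
  have hrest₀ := Finset.sum_nonneg hrest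
  have hrest_zero := (Finset.sum_eq_zero_iff_of_nonneg hrest).1 (by lia)
  refine ⟨i, hi, fun j hj => ?_⟩
  split_ifs with hji
  · subst hji
    lia
  · by_cases hjs : j ∈ s
    · exact hrest_zero j (Finset.mem_erase.2 ⟨hji, hjs⟩)
    · exact hzero j hj hjs

namespace TagAut

variable {T S : Type*} {M : TagAut T S} {tags : Finset T} {σ : PVar T S → ℤ}
  {p q v : S} {l : List (S × Finset T × S)}

/-- A tag automaton all of whose transitions, initial and final states live on its set of states. -/
structure WellFormed (M : TagAut T S) : Prop where
  source_mem : ∀ t ∈ M.trans, t.1 ∈ M.states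
  target_mem : ∀ t ∈ M.trans, t.2.2 ∈ M.states
  start_subset : M.start ⊆ M.states
  accept_subset : M.accept ⊆ M.states

/-- The transitions `l` form an accepting run from `p` to `q`. -/
structure IsRun (M : TagAut T S) (p : S) (l : List (S × Finset T × S)) (q : S) : Prop where
  start_mem : p ∈ M.start
  accept_mem : q ∈ M.accept
  walk : IsWalk p l q
  trans_mem : ∀ t ∈ l, t ∈ M.trans

open scoped Classical in
/-- The number of occurrences of the tag `τ` on a list of transitions. -/
noncomputable def tagCount (τ : T) (l : List (S × Finset T × S)) : ℕ :=
  l.countP fun t => τ ∈ t.2.1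

open scoped Classical in
@[simp]
theorem tagCount_cons (τ : T) (t : S × Finset T × S) (l : List (S × Finset T × S)) :
    tagCount τ (t :: l) = tagCount τ l + if τ ∈ t.2.1 then 1 else 0 := by
  simp [tagCount, List.countP_cons]

open scoped Classical in
/-- The conjuncts of the Parikh tag formula, read as conditions on the assignment `σ`. -/
structure IsParikhModel (M : TagAut T S) (tags : Finset T) (σ : PVar T S → ℤ) : Prop where
  trans_nonneg : ∀ t ∈ M.trans, 0 ≤ σ (.trans t)
  init_bounds : ∀ q ∈ M.start, 0 ≤ σ (.init q) ∧ σ (.init q) ≤ 1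
  init_eq_zero : ∀ q ∈ M.states, q ∉ M.start → σ (.init q) = 0
  sum_init : ∑ q ∈ M.start, σ (.init q) = 1
  final_bounds : ∀ q ∈ M.accept, 0 ≤ σ (.final q) ∧ σ (.final q) ≤ 1
  final_eq_zero : ∀ q ∈ M.states, q ∉ M.accept → σ (.final q) = 0
  kirchhoff : ∀ q ∈ M.states, σ (.init q) + ∑ t ∈ M.incoming q, σ (.trans t) =
    σ (.final q) + ∑ t ∈ M.outgoing q, σ (.trans t)
  span_eq_zero_iff : ∀ q ∈ M.states, σ (.span q) = 0 ↔ σ (.init q) = 1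
  unreached : ∀ q ∈ M.states, σ (.span q) ≤ -1 →
    σ (.init q) = 0 ∧ ∀ t ∈ M.incoming q, σ (.trans t) = 0
  exists_parent : ∀ q ∈ M.states, 0 < σ (.span q) → ∃ t ∈ M.incoming q,
    0 < σ (.trans t) ∧ 0 ≤ σ (.span t.1) ∧ σ (.span q) = σ (.span t.1) + 1
  tag_eq : ∀ τ ∈ tags, σ (.tag τ) = ∑ t ∈ M.trans with τ ∈ t.2.1, σ (.trans t)

theorem holds_parikhTagFormula_iff :
    (M.parikhTagFormula tags).Holds σ ↔ M.IsParikhModel tags σ := by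
  simp only [parikhTagFormula, parikhFormula, initFormula, finalFormula, kirchhoffFormula,
    spanFormula, LIA.Holds, LIA.holds_iff, LIA.holds_conj, LIA.holds_disj, LIA.holds_lt,
    LTerm.eval, LTerm.eval_sum, Finset.mem_sdiff, and_imp]
  constructor
  · rintro ⟨⟨h₁, ⟨h₂, h₃, h₄⟩, ⟨h₅, h₆⟩, hq⟩, htag⟩
    exact ⟨h₁, h₂, h₃, h₄, h₅, h₆, fun q h => (hq q h).1, fun q h => (hq q h).2.1,
      fun q h => (hq q h).2.2.1, fun q h => (hq q h).2.2.2, htag⟩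
  · rintro ⟨h₁, h₂, h₃, h₄, h₅, h₆, h₇, h₈, h₉, h₁₀, htag⟩
    exact ⟨⟨h₁, ⟨h₂, h₃, h₄⟩, ⟨h₅, h₆⟩,
      fun q h => ⟨h₇ q h, h₈ q h, h₉ q h, h₁₀ q h⟩⟩, htag⟩

namespace IsParikhModel

/-- The multiset of transitions whose multiplicities are the values of the transition variables. -/
def flow (M : TagAut T S) (σ : PVar T S → ℤ) : Multiset (S × Finset T × S) :=
  ∑ t ∈ M.trans, Multiset.replicate (σ (.trans t)).toNat t

theorem mem_flow {t : S × Finset T × S} : t ∈ flow M σ ↔ t ∈ M.trans ∧ 0 < σ (.trans t) := by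
  rw [flow, mem_sum_replicate, Int.lt_toNat, Nat.cast_zero]

theorem countP_flow (h : M.IsParikhModel tags σ) (P : S × Finset T × S → Prop)
    [DecidablePred P] :
    ((flow M σ).countP P : ℤ) = ∑ t ∈ M.trans with P t, σ (.trans t) := by
  rw [flow, countP_sum_replicate, Nat.cast_sum]
  exact Finset.sum_congr rfl fun t ht =>
    Int.toNat_of_nonneg (h.trans_nonneg t (Finset.mem_filter.1 ht).1)

theorem sum_final (h : M.IsParikhModel tags σ) (hM : M.WellFormed) :
    ∑ q ∈ M.accept, σ (.final q) = 1 := by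
  classical
  have hflow : ∑ q ∈ M.states, ∑ t ∈ M.incoming q, σ (.trans t) =
      ∑ q ∈ M.states, ∑ t ∈ M.outgoing q, σ (.trans t) := by
    simp only [incoming, outgoing]
    rw [Finset.sum_fiberwise_of_maps_to hM.target_mem,
      Finset.sum_fiberwise_of_maps_to hM.source_mem]
  have hkirchhoff := Finset.sum_congr rfl h.kirchhoff
  rw [Finset.sum_add_distrib, Finset.sum_add_distrib, hflow] at hkirchhoff
  calc ∑ q ∈ M.accept, σ (.final q)
      = ∑ q ∈ M.states, σ (.final q) := Finset.sum_subset hM.accept_subset h.final_eq_zero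
    _ = ∑ q ∈ M.states, σ (.init q) := (add_right_cancel hkirchhoff).symm
    _ = ∑ q ∈ M.start, σ (.init q) :=
      (Finset.sum_subset hM.start_subset h.init_eq_zero).symm
    _ = 1 := h.sum_init

open scoped Classical in
theorem exists_init (h : M.IsParikhModel tags σ) :
    ∃ p ∈ M.start, ∀ q ∈ M.states, σ (.init q) = if q = p then 1 else 0 :=
  exists_eq_ite_of_sum_eq_one (fun q hq => (h.init_bounds q hq).1) h.sum_init h.init_eq_zero

open scoped Classical in
theorem exists_final (h : M.IsParikhModel tags σ) (hM : M.WellFormed) :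
    ∃ p ∈ M.accept, ∀ q ∈ M.states, σ (.final q) = if q = p then 1 else 0 :=
  exists_eq_ite_of_sum_eq_one (fun q hq => (h.final_bounds q hq).1) (h.sum_final hM)
    h.final_eq_zero

open scoped Classical in
theorem balanced_flow (h : M.IsParikhModel tags σ) (hM : M.WellFormed)
    (hp : p ∈ M.start) (hinit : ∀ v ∈ M.states, σ (.init v) = if v = p then 1 else 0)
    (hq : q ∈ M.accept) (hfinal : ∀ v ∈ M.states, σ (.final v) = if v = q then 1 else 0) :
    IsWalk.Balanced (flow M σ) p q := by
  intro v
  by_cases hv : v ∈ M.states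
  · have := h.kirchhoff v hv
    rw [hinit v hv, hfinal v hv, incoming, outgoing, ← h.countP_flow, ← h.countP_flow] at this
    exact_mod_cast this
  · have hvp : v ≠ p := fun he => hv (he ▸ hM.start_subset hp)
    have hvq : v ≠ q := fun he => hv (he ▸ hM.accept_subset hq)
    have hin : (flow M σ).countP (fun t => t.2.2 = v) = 0 := Multiset.countP_eq_zero.2
      fun t ht he => hv (he ▸ hM.target_mem t (mem_flow.1 ht).1)
    have hout : (flow M σ).countP (fun t => t.1 = v) = 0 := Multiset.countP_eq_zero.2
      fun t ht he => hv (he ▸ hM.source_mem t (mem_flow.1 ht).1)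
    rw [hin, hout, if_neg hvp, if_neg hvq]

open scoped Classical in
theorem exists_walk_of_span_nonneg (h : M.IsParikhModel tags σ) (hM : M.WellFormed)
    (hinit : ∀ v ∈ M.states, σ (.init v) = if v = p then 1 else 0) (hv : v ∈ M.states)
    (hspan : 0 ≤ σ (.span v)) :
    ∃ l, IsWalk p l v ∧ ∀ t ∈ l, t ∈ flow M σ := by
  obtain ⟨k, hk⟩ := Int.eq_ofNat_of_zero_le hspan
  induction k generalizing v with
  | zero =>
    have hv₁ := (h.span_eq_zero_iff v hv).1 hk
    rw [hinit v hv] at hv₁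
    have hvp : v = p := by
      by_contra hne
      simp [hne] at hv₁
    exact ⟨[], hvp.symm, by simp⟩
  | succ k ih =>
    obtain ⟨t, ht, hpos, hsrc, hdepth⟩ := h.exists_parent v hv (by lia)
    rw [incoming, Finset.mem_filter] at ht
    obtain ⟨l, hl, hlflow⟩ := ih (hM.source_mem t ht.1) hsrc (by push_cast at hk; lia)
    refine ⟨l ++ [t], IsWalk.concat_iff.2 ⟨hl, ht.2⟩, fun s hs => ?_⟩
    rw [List.mem_append, List.mem_singleton] at hs
    rcases hs with hs | rfl
    · exact hlflow s hs
    · exact mem_flow.2 ⟨ht.1, hpos⟩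

open scoped Classical in
theorem span_source_nonneg (h : M.IsParikhModel tags σ) (hM : M.WellFormed)
    (hinit : ∀ v ∈ M.states, σ (.init v) = if v = p then 1 else 0)
    (hbal : IsWalk.Balanced (flow M σ) p q) {t : S × Finset T × S} (ht : t ∈ flow M σ) :
    0 ≤ σ (.span t.1) := by
  have hsrc := hM.source_mem t (mem_flow.1 ht).1
  by_contra hneg
  obtain ⟨hnotinit, hnotin⟩ := h.unreached _ hsrc (by lia)
  have hin : (flow M σ).countP (fun s => s.2.2 = t.1) = 0 := by
    have : ((flow M σ).countP (fun s => s.2.2 = t.1) : ℤ) = 0 := by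
      rw [h.countP_flow]
      exact Finset.sum_eq_zero hnotin
    exact_mod_cast this
  have hout : 0 < (flow M σ).countP (fun s => s.1 = t.1) := Multiset.countP_pos.2 ⟨t, ht, rfl⟩
  have := hbal t.1
  rw [hinit _ hsrc] at hnotinit
  split_ifs at hnotinit this <;> lia

theorem exists_run (h : M.IsParikhModel tags σ) (hM : M.WellFormed) :
    ∃ p l q, M.IsRun p l q ∧ ∀ τ ∈ tags, σ (.tag τ) = tagCount τ l := by
  classical
  obtain ⟨p, hp, hinit⟩ := h.exists_init
  obtain ⟨q, hq, hfinal⟩ := h.exists_final hM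
  have hbal := h.balanced_flow hM hp hinit hq hfinal
  obtain ⟨l, hl, hlflow⟩ := IsWalk.exists_eulerian hbal fun t ht =>
    h.exists_walk_of_span_nonneg hM hinit (hM.source_mem t (mem_flow.1 ht).1)
      (h.span_source_nonneg hM hinit hbal ht)
  refine ⟨p, l, q, ⟨hp, hq, hl, fun t ht => ?_⟩, fun τ hτ => ?_⟩
  · rw [← Multiset.mem_coe, hlflow] at ht
    exact (mem_flow.1 ht).1
  · rw [h.tag_eq τ hτ, tagCount, ← Multiset.coe_countP, hlflow, h.countP_flow]

end IsParikhModel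

open scoped Classical in
/-- The assignment read off a run from `p` to `q` with spanning depths `d`. -/
noncomputable def runAssignment (p q : S) (l : List (S × Finset T × S)) (d : S → ℤ) :
    PVar T S → ℤ
  | .init v => if v = p then 1 else 0
  | .final v => if v = q then 1 else 0
  | .span v => d v
  | .trans t => l.count t
  | .tag τ => tagCount τ l

theorem IsRun.isParikhModel (h : M.IsRun p l q) {d : S → ℤ} (hd₀ : ∀ v, d v = 0 ↔ v = p)
    (hd₁ : ∀ v, 0 ≤ d v ↔ v ∈ IsWalk.visited p l)
    (hd₂ : ∀ v, 0 < d v → ∃ t ∈ l, t.2.2 = v ∧ 0 ≤ d t.1 ∧ d v = d t.1 + 1)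
    (tags : Finset T) : M.IsParikhModel tags (runAssignment p q l d) := by
  classical
  have hcount : ∀ (P : S × Finset T × S → Prop) [DecidablePred P],
      ∑ t ∈ M.trans with P t, (l.count t : ℤ) = l.countP (fun t => P t) := fun P _ => by
    rw [← sum_count_filter_eq_countP h.trans_mem P, Nat.cast_sum]
  constructor <;> simp only [runAssignment]
  case trans_nonneg => exact fun t _ => Nat.cast_nonneg _
  case init_bounds | final_bounds => intro v _; split_ifs <;> lia
  case init_eq_zero => exact fun v _ hv => if_neg (by rintro rfl; exact hv h.start_mem)
  case sum_init => simp [h.start_mem]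
  case final_eq_zero => exact fun v _ hv => if_neg (by rintro rfl; exact hv h.accept_mem)
  case kirchhoff =>
    intro v _
    rw [incoming, outgoing, hcount, hcount]
    exact_mod_cast h.walk.balanced v
  case span_eq_zero_iff => intro v _; rw [hd₀]; split_ifs with hv <;> simp [hv]
  case unreached =>
    intro v _ hneg
    have hv : v ∉ IsWalk.visited p l := fun hv => by
      have := (hd₁ v).2 hv
      lia
    refine ⟨if_neg fun he => hv (Or.inl he), fun t ht => ?_⟩
    rw [Nat.cast_eq_zero, List.count_eq_zero]
    exact fun htl => hv (Or.inr ⟨t, htl, (Finset.mem_filter.1 ht).2⟩)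
  case exists_parent =>
    intro v _ hpos
    obtain ⟨t, ht, rfl, hsrc, hdepth⟩ := hd₂ v hpos
    exact ⟨t, Finset.mem_filter.2 ⟨h.trans_mem t ht, rfl⟩,
      by exact_mod_cast List.count_pos_iff.2 ht, hsrc, hdepth⟩
  case tag_eq => exact fun τ _ => (hcount fun t => τ ∈ t.2.1).symm

theorem exists_run_of_holds (hM : M.WellFormed) (h : (M.parikhTagFormula tags).Holds σ) :
    ∃ p l q, M.IsRun p l q ∧ ∀ τ ∈ tags, σ (.tag τ) = tagCount τ l :=
  (holds_parikhTagFormula_iff.1 h).exists_run hM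

theorem exists_holds_of_run (h : M.IsRun p l q) (tags : Finset T) :
    ∃ σ : PVar T S → ℤ, (M.parikhTagFormula tags).Holds σ ∧ ∀ τ, σ (.tag τ) = tagCount τ l := by
  obtain ⟨d, hd₀, hd₁, hd₂⟩ := h.walk.exists_spanning_depth
  exact ⟨runAssignment p q l d,
    holds_parikhTagFormula_iff.2 (h.isParikhModel hd₀ hd₁ hd₂ tags), fun _ => rfl⟩

end TagAut

/-! ### The concatenation of the automata of the variables -/

theorem TagAut.mem_concatEps_states {T S : Type*} {M N : TagAut T S} {s : S} :
    s ∈ (M.concatEps N).states ↔ s ∈ M.states ∨ s ∈ N.states := by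
  classical
  exact Finset.mem_union

theorem TagAut.mem_concatEps_trans {T S : Type*} {M N : TagAut T S} {t : S × Finset T × S} :
    t ∈ (M.concatEps N).trans ↔
      t ∈ M.trans ∨ t ∈ N.trans ∨ ∃ s ∈ M.accept, ∃ r ∈ N.start, t = (s, ∅, r) := by
  classical
  simp only [concatEps, Finset.mem_union, Finset.mem_image, Finset.mem_product, Prod.exists,
    or_assoc, and_assoc, exists_and_left, eq_comm (a := t)]

theorem mem_acceptsFrom_iff_exists {A Q : Type*} {M : NFA A Q} {s : Set Q} {w : List A} :
    w ∈ M.acceptsFrom s ↔ ∃ q ∈ s, w ∈ M.acceptsFrom {q} := by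
  conv_lhs => rw [← Set.biUnion_of_singleton s]
  rw [NFA.acceptsFrom_iUnion₂]
  exact Set.mem_iUnion₂.trans (by simp only [exists_prop]; rfl)

theorem eq_of_cons_suffix_of_nodup {α : Type*} {x : α} {k l m : List α} (hm : m.Nodup)
    (hk : x :: k <:+ m) (hl : x :: l <:+ m) : k = l := by
  wlog h : x :: k <:+ x :: l generalizing k l
  · exact (this hl hk ((List.suffix_or_suffix_of_suffix hk hl).resolve_left h)).symm
  · rcases List.suffix_cons_iff.1 h with h | h
    · exact List.tail_eq_of_cons_eq h
    · exact absurd (h.mem List.mem_cons_self) (List.nodup_cons.1 (hm.sublist hl.sublist)).1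

namespace MultiDiseq

variable {A : Type uA} {X : Type uX} {Q : X → Type uQ} {I : Type uI} {n : ℕ}

open scoped Classical in
/-- The words `u` with the letter `a` prepended to the word of `z`. -/
noncomputable def consAt (u : X → List A) (z : X) (a : A) : X → List A :=
  Function.update u z (a :: u z)

@[simp]
theorem consAt_self (u : X → List A) (z : X) (a : A) : consAt u z a z = a :: u z := by
  classical
  exact Function.update_self ..

theorem consAt_of_ne (u : X → List A) {x z : X} (a : A) (h : x ≠ z) : consAt u z a x = u x := by
  classical
  exact Function.update_of_ne h ..

theorem exists_eq_consAt {u : X → List A} {z : X} {a : A} {w : List A} (h : u z = a :: w) :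
    ∃ u', u = consAt u' z a ∧ u' z = w := by
  classical
  exact ⟨Function.update u z w, by simp [consAt, ← h], Function.update_self ..⟩

open scoped Classical in
/-- `CRun M q u r`: some run of `M` from `q` to `r` reads the word `u x` in every variable `x`. -/
inductive CRun {S : Type*} (M : TagAut (Tag A X n) S) : S → (X → List A) → S → Prop
  | nil (q : S) : CRun M q (fun _ => []) q
  | read {q q' r : S} {u : X → List A} (a : A) (z : X)
      (ht : (q, {Tag.sym a, Tag.len z}, q') ∈ M.trans) (h : CRun M q' u r) :
      CRun M q (consAt u z a) r
  | eps {q q' r : S} {u : X → List A} (ht : (q, ∅, q') ∈ M.trans) (h : CRun M q' u r) :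
      CRun M q u r

open scoped Classical in
theorem sym_len_inj {a b : A} {y z : X} :
    ({Tag.sym a, Tag.len y} : Finset (Tag A X n)) = {Tag.sym b, Tag.len z} ↔ a = b ∧ y = z := by
  refine ⟨fun h => ?_, by rintro ⟨rfl, rfl⟩; rfl⟩
  have ha : Tag.sym a ∈ ({Tag.sym b, Tag.len z} : Finset (Tag A X n)) := by simp [← h]
  have hy : Tag.len y ∈ ({Tag.sym b, Tag.len z} : Finset (Tag A X n)) := by simp [← h]
  simpa using And.intro ha hy

/-- The words `u` can be read from the state `s` of the automaton of the variable `s.1` on, if the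
automata of the variables in `l` are still to come. -/
structure ReadableFrom (C : DiseqConstraint A X Q I n) (s : Σ x, Q x) (l : List X)
    (u : X → List A) : Prop where
  current : u s.1 ∈ (C.nfa s.1).acceptsFrom {s.2}
  later : ∀ y ∈ l, u y ∈ (C.nfa y).accepts
  earlier : ∀ y, y ≠ s.1 → y ∉ l → u y = []

namespace ReadableFrom

variable {C : DiseqConstraint A X Q I n} {s : Σ x, Q x} {x : X} {l : List X} {u : X → List A}

theorem nil_iff :
    ReadableFrom C s [] u ∧ u s.1 = [] ↔ s.2 ∈ (C.nfa s.1).accept ∧ u = fun _ => [] := by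
  constructor
  · rintro ⟨⟨hs, -, hu⟩, h⟩
    refine ⟨by simpa [h] using hs, funext fun y => ?_⟩
    by_cases hy : y = s.1
    · rw [hy, h]
    · exact hu y hy List.not_mem_nil
  · rintro ⟨hs, rfl⟩
    exact ⟨⟨by simpa using hs, by simp, fun _ _ _ => rfl⟩, rfl⟩

theorem consAt_iff {p : Q x} {a : A} (hx : x ∉ l) :
    ReadableFrom C ⟨x, p⟩ l (consAt u x a) ↔
      ∃ q ∈ (C.nfa x).step p a, ReadableFrom C ⟨x, q⟩ l u := by
  have hl : ∀ y ∈ l, consAt u x a y = u y := fun y hy =>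
    consAt_of_ne u a (ne_of_mem_of_not_mem hy hx)
  have hne : ∀ y, y ≠ x → consAt u x a y = u y := fun y hy => consAt_of_ne u a hy
  constructor
  · rintro ⟨hp, hlater, hearlier⟩
    simp only [consAt_self, NFA.cons_mem_acceptsFrom, NFA.stepSet_singleton] at hp
    obtain ⟨q, hq, hu⟩ := mem_acceptsFrom_iff_exists.1 hp
    exact ⟨q, hq, hu, fun y hy => hl y hy ▸ hlater y hy,
      fun y hy hy' => hne y hy ▸ hearlier y hy hy'⟩
  · rintro ⟨q, hq, hu, hlater, hearlier⟩
    refine ⟨?_, fun y hy => (hl y hy).symm ▸ hlater y hy,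
      fun y hy hy' => (hne y hy).symm ▸ hearlier y hy hy'⟩
    simp only [consAt_self, NFA.cons_mem_acceptsFrom, NFA.stepSet_singleton]
    exact mem_acceptsFrom_iff_exists.2 ⟨q, hq, hu⟩

theorem cons_iff {y : X} (hs : s.1 ∉ y :: l) :
    ReadableFrom C s (y :: l) u ∧ u s.1 = [] ↔
      s.2 ∈ (C.nfa s.1).accept ∧ ∃ q ∈ (C.nfa y).start, ReadableFrom C ⟨y, q⟩ l u := by
  rw [List.mem_cons, not_or] at hs
  constructor
  · rintro ⟨⟨hcur, hlater, hearlier⟩, h⟩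
    obtain ⟨q, hq, hy⟩ := mem_acceptsFrom_iff_exists.1 (hlater y List.mem_cons_self)
    refine ⟨by simpa [h] using hcur, q, hq, hy, fun z hz => hlater z (List.mem_cons_of_mem _ hz),
      fun z hzy hzl => ?_⟩
    by_cases hzs : z = s.1
    · rw [hzs, h]
    · exact hearlier z hzs (List.not_mem_cons_of_ne_of_not_mem hzy hzl)
  · rintro ⟨hacc, q, hq, hcur, hlater, hearlier⟩
    have hs' : u s.1 = [] := hearlier _ hs.1 hs.2
    refine ⟨⟨by simpa [hs'] using hacc, List.forall_mem_cons.2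
      ⟨mem_acceptsFrom_iff_exists.2 ⟨q, hq, hcur⟩, hlater⟩, fun z _ hz => ?_⟩, hs'⟩
    rw [List.mem_cons, not_or] at hz
    exact hearlier z hz.1 hz.2

end ReadableFrom

section ConcatVars

variable [Fintype A] [∀ x, Fintype (Q x)]

section LenTagAut

variable {x : X} {M : NFA A (Q x)} {s : Σ x, Q x}

theorem mem_lenTagAut_states : s ∈ (lenTagAut n x M).states ↔ s.1 = x := by
  simp only [lenTagAut, Finset.mem_image, Finset.mem_univ, true_and]
  exact ⟨by rintro ⟨p, rfl⟩; rfl, by rintro rfl; exact ⟨s.2, rfl⟩⟩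

theorem mem_lenTagAut_start : s ∈ (lenTagAut n x M).start ↔ ∃ p ∈ M.start, s = ⟨x, p⟩ := by
  simp only [lenTagAut, Finset.mem_image, Finset.mem_filter, Finset.mem_univ, true_and,
    eq_comm (a := s)]

theorem mem_lenTagAut_accept : s ∈ (lenTagAut n x M).accept ↔ ∃ p ∈ M.accept, s = ⟨x, p⟩ := by
  simp only [lenTagAut, Finset.mem_image, Finset.mem_filter, Finset.mem_univ, true_and,
    eq_comm (a := s)]

open scoped Classical in
theorem mem_lenTagAut_trans {t : (Σ x, Q x) × Finset (Tag A X n) × (Σ x, Q x)} :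
    t ∈ (lenTagAut n x M).trans ↔
      ∃ p a q, q ∈ M.step p a ∧ t = (⟨x, p⟩, {Tag.sym a, Tag.len x}, ⟨x, q⟩) := by
  simp only [lenTagAut, Finset.mem_image, Finset.mem_filter, Finset.mem_univ, true_and,
    Prod.exists, eq_comm (a := t)]

end LenTagAut

/-- The `ε`-concatenation of the automata of the variables in a list, which need not contain all
variables: the lemmas about `conAut` are proved by induction on this list. -/
noncomputable def concatVars (C : DiseqConstraint A X Q I n) (vs : List X) :
    TagAut (Tag A X n) (Σ x, Q x) :=
  TagAut.concatList (vs.map fun x => lenTagAut n x (C.nfa x))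

variable (C : DiseqConstraint A X Q I n) {vs l : List X} {x : X} {s r : Σ x, Q x}
  {u : X → List A}

theorem concatVars_cons_cons (x y : X) (l : List X) :
    concatVars C (x :: y :: l) = (lenTagAut n x (C.nfa x)).concatEps (concatVars C (y :: l)) :=
  rfl

theorem mem_concatVars_states : s ∈ (concatVars C vs).states ↔ s.1 ∈ vs := by
  induction vs with
  | nil => simp [concatVars, TagAut.concatList]
  | cons x l ih =>
    cases l with
    | nil => exact mem_lenTagAut_states.trans List.mem_singleton.symm
    | cons y l =>
      rw [concatVars_cons_cons, TagAut.mem_concatEps_states, mem_lenTagAut_states, ih,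
        ← List.mem_cons]

theorem mem_concatVars_start :
    s ∈ (concatVars C (x :: l)).start ↔ ∃ p ∈ (C.nfa x).start, s = ⟨x, p⟩ := by
  rw [← mem_lenTagAut_start (n := n)]
  cases l <;> rfl

theorem mem_concatVars_accept :
    s ∈ (concatVars C vs).accept ↔ s.2 ∈ (C.nfa s.1).accept ∧ [s.1] <:+ vs := by
  induction vs with
  | nil => simp [concatVars, TagAut.concatList]
  | cons x l ih =>
    cases l with
    | nil =>
      refine mem_lenTagAut_accept.trans ⟨?_, ?_⟩
      · rintro ⟨p, hp, rfl⟩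
        exact ⟨hp, List.suffix_rfl⟩
      · obtain ⟨y, p⟩ := s
        rintro ⟨hp, h⟩
        obtain rfl : y = x := by simpa [List.suffix_cons_iff] using h
        exact ⟨p, hp, rfl⟩
    | cons y l =>
      rw [List.suffix_cons_iff (a := x), or_iff_right (by simp)]
      exact ih

theorem mem_concatVars_trans {t : (Σ x, Q x) × Finset (Tag A X n) × (Σ x, Q x)} :
    t ∈ (concatVars C vs).trans ↔ (∃ x ∈ vs, t ∈ (lenTagAut n x (C.nfa x)).trans) ∨
      ∃ s r l, s.1 :: r.1 :: l <:+ vs ∧ s.2 ∈ (C.nfa s.1).accept ∧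
        r.2 ∈ (C.nfa r.1).start ∧ t = (s, ∅, r) := by
  induction vs with
  | nil => simp [concatVars, TagAut.concatList]
  | cons x l ih =>
    cases l with
    | nil => simp [concatVars, TagAut.concatList, List.suffix_cons_iff]
    | cons y l =>
      rw [concatVars_cons_cons, TagAut.mem_concatEps_trans, ih, List.exists_mem_cons_iff _ x,
        or_assoc, or_assoc]
      refine or_congr_right ⟨?_, ?_⟩
      · rintro (h | ⟨s, r, k, h, h'⟩ | ⟨s, hs, r, hr, rfl⟩)
        · exact Or.inl h
        · exact Or.inr ⟨s, r, k, h.trans (List.suffix_cons x _), h'⟩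
        · obtain ⟨p, hp, rfl⟩ := mem_lenTagAut_accept.1 hs
          obtain ⟨q, hq, rfl⟩ := (mem_concatVars_start C).1 hr
          exact Or.inr ⟨_, _, l, List.suffix_rfl, hp, hq, rfl⟩
      · rintro (h | ⟨⟨z, p⟩, ⟨w, q⟩, k, h, hp, hq, rfl⟩)
        · exact Or.inl h
        · rcases List.suffix_cons_iff.1 h with h | h
          · obtain ⟨rfl, rfl, rfl⟩ : z = x ∧ w = y ∧ k = l := by simpa using h
            exact Or.inr (Or.inr ⟨_, mem_lenTagAut_accept.2 ⟨p, hp, rfl⟩, _,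
              (mem_concatVars_start C).2 ⟨q, hq, rfl⟩, rfl⟩)
          · exact Or.inr (Or.inl ⟨_, _, k, h, hp, hq, rfl⟩)

open scoped Classical in
theorem read_mem_concatVars_trans {a : A} {z : X} :
    (s, {Tag.sym a, Tag.len z}, r) ∈ (concatVars C vs).trans ↔
      z ∈ vs ∧ ∃ p q, s = ⟨z, p⟩ ∧ r = ⟨z, q⟩ ∧ q ∈ (C.nfa z).step p a := by
  simp only [mem_concatVars_trans, mem_lenTagAut_trans, Prod.mk.injEq, sym_len_inj]
  constructor
  · rintro (⟨_, hz, p, _, q, hq, rfl, ⟨rfl, rfl⟩, rfl⟩ | ⟨_, _, _, _, _, _, _, h, _⟩)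
    · exact ⟨hz, p, q, rfl, rfl, hq⟩
    · exact absurd h (Finset.insert_ne_empty _ _)
  · rintro ⟨hz, p, q, rfl, rfl, hq⟩
    exact Or.inl ⟨z, hz, p, a, q, hq, rfl, by simp, rfl⟩

theorem eps_mem_concatVars_trans :
    (s, ∅, r) ∈ (concatVars C vs).trans ↔
      s.2 ∈ (C.nfa s.1).accept ∧ r.2 ∈ (C.nfa r.1).start ∧ ∃ l, s.1 :: r.1 :: l <:+ vs := by
  simp only [mem_concatVars_trans, mem_lenTagAut_trans, Prod.mk.injEq]
  constructor
  · rintro (⟨_, _, _, _, _, _, _, h, _⟩ | ⟨_, _, l, hl, hs, hr, rfl, -, rfl⟩)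
    · exact absurd h.symm (by simp)
    · exact ⟨hs, hr, l, hl⟩
  · rintro ⟨hs, hr, l, hl⟩
    exact Or.inr ⟨s, r, l, hl, hs, hr, rfl, by simp, rfl⟩

theorem CRun.readableFrom (hvs : vs.Nodup) (h : CRun (concatVars C vs) s u r)
    (hr : r ∈ (concatVars C vs).accept) (hs : s.1 :: l <:+ vs) : ReadableFrom C s l u := by
  induction h generalizing l with
  | nil s =>
    obtain ⟨hacc, hlast⟩ := (mem_concatVars_accept C).1 hr
    obtain rfl := eq_of_cons_suffix_of_nodup hvs hs hlast
    exact (ReadableFrom.nil_iff.2 ⟨hacc, rfl⟩).1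
  | read a z ht _ ih =>
    obtain ⟨-, p, q, rfl, rfl, hq⟩ := (read_mem_concatVars_trans C).1 ht
    exact (ReadableFrom.consAt_iff (List.nodup_cons.1 (hvs.sublist hs.sublist)).1).2
      ⟨q, hq, ih hr hs⟩
  | eps ht _ ih =>
    obtain ⟨hacc, hst, k, hk⟩ := (eps_mem_concatVars_trans C).1 ht
    obtain rfl := eq_of_cons_suffix_of_nodup hvs hs hk
    exact ((ReadableFrom.cons_iff (List.nodup_cons.1 (hvs.sublist hs.sublist)).1).2
      ⟨hacc, _, hst, ih hr ((List.suffix_cons _ _).trans hk)⟩).1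

theorem ReadableFrom.exists_cRun (hvs : vs.Nodup) {x : X} {p : Q x} {l : List X}
    {u : X → List A} (h : ReadableFrom C ⟨x, p⟩ l u)
    (hs : x :: l <:+ vs) : ∃ r ∈ (concatVars C vs).accept, CRun (concatVars C vs) ⟨x, p⟩ u r := by
  have hx : x ∉ l := (List.nodup_cons.1 (hvs.sublist hs.sublist)).1
  match hu : u x, l with
  | a :: w, l =>
    obtain ⟨u, rfl, rfl⟩ := exists_eq_consAt hu
    obtain ⟨q, hq, h'⟩ := (ReadableFrom.consAt_iff hx).1 h
    obtain ⟨r, hr, hrun⟩ := ReadableFrom.exists_cRun hvs h' hs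
    exact ⟨r, hr, .read a x ((read_mem_concatVars_trans C).2
      ⟨hs.mem List.mem_cons_self, p, q, rfl, rfl, hq⟩) hrun⟩
  | [], [] =>
    obtain ⟨hacc, rfl⟩ := ReadableFrom.nil_iff.1 ⟨h, hu⟩
    exact ⟨_, (mem_concatVars_accept C).2 ⟨hacc, hs⟩, .nil _⟩
  | [], y :: l =>
    obtain ⟨hacc, q, hq, h'⟩ := (ReadableFrom.cons_iff hx).1 ⟨h, hu⟩
    obtain ⟨r, hr, hrun⟩ := ReadableFrom.exists_cRun hvs h' ((List.suffix_cons _ _).trans hs)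
    exact ⟨r, hr, .eps ((eps_mem_concatVars_trans C).2 ⟨hacc, hq, l, hs⟩) hrun⟩
termination_by (l.length, (u x).length)

theorem exists_cRun_conAut_iff [Fintype X] [LinearOrder X] [Nonempty X] (u : X → List A) :
    (∃ s ∈ (conAut C).start, ∃ r ∈ (conAut C).accept, CRun (conAut C) s u r) ↔
      ∀ x, u x ∈ (C.nfa x).accepts := by
  have hcon : conAut C = concatVars C ((Finset.univ : Finset X).sort (· ≤ ·)) := rfl
  have hvs : ((Finset.univ : Finset X).sort (· ≤ ·)).Nodup := Finset.sort_nodup _ _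
  have hmem : ∀ x, x ∈ (Finset.univ : Finset X).sort (· ≤ ·) := fun x => by simp
  rw [hcon]
  generalize (Finset.univ : Finset X).sort (· ≤ ·) = vs at hvs hmem
  obtain ⟨x, l, rfl⟩ := List.exists_cons_of_ne_nil
    (List.ne_nil_of_mem (hmem (Classical.arbitrary X)))
  constructor
  · rintro ⟨s, hs, r, hr, h⟩ y
    obtain ⟨p, hp, rfl⟩ := (mem_concatVars_start C).1 hs
    have hu := h.readableFrom C hvs hr List.suffix_rfl
    rcases List.mem_cons.1 (hmem y) with rfl | hy
    · exact mem_acceptsFrom_iff_exists.2 ⟨p, hp, hu.current⟩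
    · exact hu.later y hy
  · intro h
    obtain ⟨p, hp, hx⟩ := mem_acceptsFrom_iff_exists.1 (h x)
    have hu : ReadableFrom C ⟨x, p⟩ l u := ⟨hx, fun y _ => h y, fun y hyx hyl =>
      absurd (hmem y) (List.not_mem_cons_of_ne_of_not_mem hyx hyl)⟩
    obtain ⟨r, hr, hrun⟩ := hu.exists_cRun C hvs List.suffix_rfl
    exact ⟨⟨x, p⟩, (mem_concatVars_start C).2 ⟨p, hp, rfl⟩, r, hr, hrun⟩

end ConcatVars

end MultiDiseq

/-! ### Runs of the tag automaton -/

theorem countP_zipIdx_eq_ite {α : Type*} {p : α × ℕ → Bool} {i k : ℕ}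
    (hp : ∀ x, p x → x.2 = i + k) (l : List α) :
    (l.zipIdx i).countP p = if ∃ a ∈ l[k]?, p (a, i + k) then 1 else 0 := by
  induction l generalizing i k with
  | nil => simp
  | cons a l ih =>
    rw [List.zipIdx_cons, List.countP_cons]
    cases k with
    | zero =>
      have : (l.zipIdx (i + 1)).countP p = 0 := List.countP_eq_zero.2 fun x hx h => by
        have := List.le_snd_of_mem_zipIdx hx
        have := hp x h
        lia
      simp [this]
    | succ k =>
      rw [ih (k := k) fun x hx => (hp x hx).trans (by lia), if_neg (c := p (a, i) = true)
        fun h => by simpa using hp _ h, List.getElem?_cons_succ, Nat.add_right_comm, add_assoc,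
        add_zero]

namespace MultiDiseq

open TagAut (tagCount tagCount_cons)

variable {A : Type uA} {X : Type uX} {Q : X → Type uQ} {I : Type uI} {n : ℕ}

/-- A mismatch (with its letter) or copy (without letter) transition of a run, together with the
number of letters of every variable that are read before it. -/
structure Sample (A : Type uA) (X : Type uX) (n : ℕ) where
  var : X
  diseq : Fin n
  side : Side
  letter : Option A
  pos : X → ℕ

/-- The tag of a sample on level `i`. -/
def Sample.tag (e : Sample A X n) (i : ℕ) : Tag A X n :=
  match e.letter with
  | some a => .mis i e.var e.diseq e.side a
  | none => .cop i e.var e.diseq e.side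

namespace Sample

variable {e e' : Sample A X n} {i j : ℕ}

@[simp]
theorem tag_mk_some {x : X} {D : Fin n} {s : Side} {a : A} {pos : X → ℕ} :
    (⟨x, D, s, some a, pos⟩ : Sample A X n).tag i = .mis i x D s a := rfl

@[simp]
theorem tag_mk_none {x : X} {D : Fin n} {s : Side} {pos : X → ℕ} :
    (⟨x, D, s, none, pos⟩ : Sample A X n).tag i = .cop i x D s := rfl

@[simp]
theorem tag_eq_mis_iff {x : X} {D : Fin n} {s : Side} {a : A} :
    e.tag i = .mis j x D s a ↔
      i = j ∧ e.var = x ∧ e.diseq = D ∧ e.side = s ∧ e.letter = some a := by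
  obtain ⟨_, _, _, _ | _, _⟩ := e <;> simp

@[simp]
theorem tag_eq_cop_iff {x : X} {D : Fin n} {s : Side} :
    e.tag i = .cop j x D s ↔ i = j ∧ e.var = x ∧ e.diseq = D ∧ e.side = s ∧ e.letter = none := by
  obtain ⟨_, _, _, _ | _, _⟩ := e <;> simp

@[simp]
theorem tag_ne_sym {a : A} : e.tag i ≠ .sym a := by
  obtain ⟨_, _, _, _ | _, _⟩ := e <;> simp

@[simp]
theorem tag_ne_len {x : X} : e.tag i ≠ .len x := by
  obtain ⟨_, _, _, _ | _, _⟩ := e <;> simp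

@[simp]
theorem tag_ne_pos {x : X} : e.tag i ≠ .pos j x := by
  obtain ⟨_, _, _, _ | _, _⟩ := e <;> simp

theorem eq_of_tag_eq_tag (h : e.tag i = e'.tag j) : i = j := by
  obtain ⟨_, _, _, _ | _, _⟩ := e'
  · exact (tag_eq_cop_iff.1 h).1
  · exact (tag_eq_mis_iff.1 h).1

end Sample

open scoped Classical in
/-- `MRun M i pos q L E u r`: the transitions `L` lead from level `i` of the state `q` to the state
`r`, sample `E` and read the words `u`; the letters read are counted from `pos` on. -/
inductive MRun {S : Type*} (M : TagAut (Tag A X n) S) : ℕ → (X → ℕ) → S →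
    List ((S × ℕ) × Finset (Tag A X n) × (S × ℕ)) → List (Sample A X n) → (X → List A) → S → Prop
  | nil (i : ℕ) (pos : X → ℕ) (q : S) : MRun M i pos q [] [] (fun _ => []) q
  | read {i : ℕ} {pos : X → ℕ} {q q' r : S} {L E} {u : X → List A} (a : A) (z : X)
      (hi : 1 ≤ i) (ht : (q, {Tag.sym a, Tag.len z}, q') ∈ M.trans)
      (h : MRun M i (pos + Pi.single z 1) q' L E u r) :
      MRun M i pos q (((q, i), {Tag.sym a, Tag.len z, Tag.pos i z}, (q', i)) :: L) E
        (consAt u z a) r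
  | eps {i : ℕ} {pos : X → ℕ} {q q' r : S} {L E} {u : X → List A}
      (hi : 1 ≤ i) (ht : (q, ∅, q') ∈ M.trans) (h : MRun M i pos q' L E u r) :
      MRun M i pos q (((q, i), ∅, (q', i)) :: L) E u r
  | mis {i : ℕ} {pos : X → ℕ} {q q' r : S} {L E} {u : X → List A} (a : A) (z : X) (D : Fin n)
      (s : Side) (hi : 1 ≤ i) (ht : (q, {Tag.sym a, Tag.len z}, q') ∈ M.trans)
      (h : MRun M (i + 1) (pos + Pi.single z 1) q' L E u r) :
      MRun M i pos q
        (((q, i), {Tag.sym a, Tag.mis i z D s a, Tag.len z, Tag.pos (i + 1) z}, (q', i + 1)) :: L)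
        (⟨z, D, s, some a, pos⟩ :: E) (consAt u z a) r
  | cop {i : ℕ} {pos : X → ℕ} {q r : S} {L E} {u : X → List A} (z : X) (D : Fin n)
      (s : Side) (hi : 2 ≤ i) (ht : q ∈ M.states)
      (h : MRun M (i + 1) pos q L E u r) :
      MRun M i pos q (((q, i), {Tag.cop i z D s}, (q, i + 1)) :: L)
        (⟨z, D, s, none, pos⟩ :: E) u r

theorem length_consAt (u : X → List A) (z : X) (a : A) (x : X) [Decidable (x = z)] :
    (consAt u z a x).length = (u x).length + if x = z then 1 else 0 := by
  split_ifs with h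
  · rw [h, consAt_self, List.length_cons]
  · rw [consAt_of_ne u a h, add_zero]

open scoped Classical in
theorem drop_add_single {w u : X → List A} {pos : X → ℕ} {z : X} {a : A}
    (hw : ∀ x, (w x).drop (pos x) = consAt u z a x) (x : X) :
    (w x).drop ((pos + Pi.single z 1 : X → ℕ) x) = u x := by
  rw [Pi.add_apply, ← List.drop_drop, hw]
  rcases eq_or_ne x z with rfl | hx
  · simp
  · simp [consAt_of_ne u a hx, hx]

theorem getElem?_of_drop_eq_consAt {w u : X → List A} {pos : X → ℕ} {z : X} {a : A}
    (hw : ∀ x, (w x).drop (pos x) = consAt u z a x) : (w z)[pos z]? = some a := by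
  have h : ((w z).drop (pos z))[0]? = (consAt u z a z)[0]? := by rw [hw]
  simpa using h

namespace MRun

variable {S : Type*} {M : TagAut (Tag A X n) S} {i : ℕ} {pos : X → ℕ} {q r : S}
  {L : List ((S × ℕ) × Finset (Tag A X n) × (S × ℕ))} {E : List (Sample A X n)} {u : X → List A}

theorem cRun (h : MRun M i pos q L E u r) : CRun M q u r := by
  induction h with
  | nil _ _ q => exact .nil q
  | read a z _ ht _ ih => exact .read a z ht ih
  | eps _ ht _ ih => exact .eps ht ih
  | mis a z _ _ _ ht _ ih => exact .read a z ht ih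
  | cop _ _ _ _ _ _ ih => exact ih

theorem tagCount_len (h : MRun M i pos q L E u r) (x : X) :
    tagCount (.len x) L = (u x).length := by
  classical
  induction h with
  | nil => rfl
  | _ => simp [tagCount_cons, length_consAt, *]

open scoped Classical in
theorem tagCount_tag_eq_countP (h : MRun M i pos q L E u r)
    (e : Sample A X n) (j : ℕ) :
    tagCount (e.tag j) L = (E.zipIdx i).countP fun x => e.tag j = x.1.tag x.2 := by
  induction h with
  | nil => rfl
  | _ => simp [tagCount_cons, List.zipIdx_cons, List.countP_cons, *]

open scoped Classical in
theorem tagCount_tag (h : MRun M i pos q L E u r) (k : ℕ) (e : Sample A X n) :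
    tagCount (e.tag (i + k)) L =
      if ∃ e' ∈ E[k]?, e.tag (i + k) = e'.tag (i + k) then 1 else 0 := by
  rw [h.tagCount_tag_eq_countP, countP_zipIdx_eq_ite fun x hx =>
    (Sample.eq_of_tag_eq_tag (of_decide_eq_true hx)).symm]
  simp only [decide_eq_true_eq]

theorem tagCount_pos_eq_zero (h : MRun M i pos q L E u r) {j : ℕ} (hj : j < i) (v : X) :
    tagCount (.pos j v) L = 0 := by
  induction h with
  | nil => rfl
  | read _ _ _ _ _ ih => simp [tagCount_cons, ih hj, hj.ne]
  | eps _ _ _ ih => simp [tagCount_cons, ih hj]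
  | mis _ _ _ _ _ _ _ ih => simp [tagCount_cons, ih (by lia), (Nat.lt_succ_of_lt hj).ne]
  | cop _ _ _ _ _ _ ih => simp [tagCount_cons, ih (by lia)]

/-- A mismatch transition leaving level `i` counts its own letter on level `i + 1`, so the levels
up to `i` count exactly the letters read before it. -/
theorem sum_tagCount_pos (h : MRun M i pos q L E u r) (hi : 1 ≤ i) (v : X) {k : ℕ}
    {e : Sample A X n} (he : E[k]? = some e) :
    pos v + ∑ j ∈ Finset.Icc 1 (i + k), tagCount (.pos j v) L = e.pos v := by
  classical
  have sum_ite : ∀ {l m : ℕ} (z : X), 1 ≤ l → l ≤ m →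
      ∑ j ∈ Finset.Icc 1 m, (if j = l ∧ v = z then 1 else 0) = if v = z then 1 else 0 :=
    fun z h1 hm => by simp only [ite_and, Finset.sum_ite_eq', Finset.mem_Icc, h1, hm, and_self,
      if_true]
  have sum_eq_zero : ∀ {m : ℕ} {f : ℕ → ℕ}, (∀ j ≤ m, f j = 0) →
      ∑ j ∈ Finset.Icc 1 m, f j = 0 :=
    fun hf => Finset.sum_eq_zero fun j hj => hf j (Finset.mem_Icc.1 hj).2
  induction h generalizing k with
  | nil => simp at he
  | read _ z _ _ _ ih =>
    rw [← ih hi he]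
    simp only [tagCount_cons, Finset.mem_insert, Finset.mem_singleton, reduceCtorEq,
      Tag.pos.injEq, false_or, Finset.sum_add_distrib,
      sum_ite z hi (Nat.le_add_right _ k), Pi.add_apply, Pi.single_apply]
    ring
  | eps _ _ _ ih => simp [← ih hi he, tagCount_cons]
  | mis _ z _ _ _ _ h ih =>
    cases k with
    | zero =>
      obtain rfl := Option.some_inj.1 he
      exact Nat.add_eq_left.2 (sum_eq_zero fun j hj => by
        simp [tagCount_cons, h.tagCount_pos_eq_zero (j := j) (by lia), (Nat.lt_succ_of_le hj).ne])
    | succ k =>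
      rw [← ih (by lia) he, add_comm k, ← add_assoc]
      simp only [tagCount_cons, Finset.mem_insert, Finset.mem_singleton, reduceCtorEq,
        Tag.pos.injEq, false_or, Finset.sum_add_distrib,
        sum_ite z (Nat.le_add_left 1 _) (Nat.le_add_right _ k), Pi.add_apply, Pi.single_apply]
      ring
  | cop _ _ _ _ _ h ih =>
    cases k with
    | zero =>
      obtain rfl := Option.some_inj.1 he
      exact Nat.add_eq_left.2 (sum_eq_zero fun j hj => by
        simp [tagCount_cons, h.tagCount_pos_eq_zero (j := j) (by lia)])
    | succ k => simp [← ih (by lia) he, tagCount_cons, add_assoc, add_comm 1 k]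

theorem getElem?_var_eq_letter (h : MRun M i pos q L E u r) {w : X → List A}
    (hw : ∀ x, (w x).drop (pos x) = u x) {e : Sample A X n} (he : e ∈ E) {a : A}
    (ha : e.letter = some a) : (w e.var)[e.pos e.var]? = some a := by
  classical
  induction h with
  | nil => simp at he
  | read _ _ _ _ _ ih => exact ih (drop_add_single hw) he
  | eps _ _ _ ih => exact ih hw he
  | mis _ _ _ _ _ _ _ ih =>
    rcases List.mem_cons.1 he with rfl | he
    · exact (getElem?_of_drop_eq_consAt hw).trans ha
    · exact ih (drop_add_single hw) he
  | cop _ _ _ _ _ _ ih =>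
    rcases List.mem_cons.1 he with rfl | he
    · simp at ha
    · exact ih hw he

theorem letter_ne_none (h : MRun M 1 pos q L E u r) {e : Sample A X n} (he : E[0]? = some e) :
    e.letter ≠ none := by
  generalize hi : 1 = i at h
  induction h with
  | nil => simp at he
  | read _ _ _ _ _ ih => exact ih he hi
  | eps _ _ _ ih => exact ih he hi
  | mis _ _ _ _ _ _ _ _ =>
    obtain rfl := Option.some_inj.1 he
    simp
  | cop _ _ _ hi' => lia

end MRun

section MultiAut

variable [Fintype A] [Fintype X] [∀ x, Fintype (Q x)] [LinearOrder X]
  (C : DiseqConstraint A X Q I n)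

open scoped Classical in
theorem mem_multiAut_trans {t : ((Σ x, Q x) × ℕ) × Finset (Tag A X n) × ((Σ x, Q x) × ℕ)} :
    t ∈ (multiAut C).trans ↔
      (∃ q a z r i, (q, {Tag.sym a, Tag.len z}, r) ∈ (conAut C).trans ∧ (1 ≤ i ∧ i ≤ 2 * n + 1) ∧
        t = ((q, i), {Tag.sym a, Tag.len z, Tag.pos i z}, (r, i))) ∨
      (∃ q r i, (q, ∅, r) ∈ (conAut C).trans ∧ (1 ≤ i ∧ i ≤ 2 * n + 1) ∧
        t = ((q, i), ∅, (r, i))) ∨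
      (∃ q a z r i D s, (q, {Tag.sym a, Tag.len z}, r) ∈ (conAut C).trans ∧ (1 ≤ i ∧ i ≤ 2 * n) ∧
        t = ((q, i), {Tag.sym a, Tag.mis i z D s a, Tag.len z, Tag.pos (i + 1) z}, (r, i + 1))) ∨
      (∃ q i x D s, q ∈ (conAut C).states ∧ (2 ≤ i ∧ i ≤ 2 * n) ∧
        t = ((q, i), {Tag.cop i x D s}, (q, i + 1))) := by
  simp only [multiAut, Finset.mem_union, Finset.mem_image, Finset.mem_product, readMoves, epsMoves,
    Finset.mem_filter, Finset.mem_univ, true_and, and_true, Finset.mem_Icc, or_assoc, Prod.exists,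
    and_assoc, eq_comm (b := t)]

theorem exists_mRun_of_walk {L : List (((Σ x, Q x) × ℕ) × Finset (Tag A X n) × ((Σ x, Q x) × ℕ))}
    {p r : (Σ x, Q x) × ℕ} (hL : IsWalk p L r) (hm : ∀ t ∈ L, t ∈ (multiAut C).trans)
    (hp : p.2 ≤ 2 * n + 1) (pos : X → ℕ) :
    ∃ E u, MRun (conAut C) p.2 pos p.1 L E u r.1 ∧ p.2 + E.length ≤ 2 * n + 1 := by
  induction L generalizing p pos with
  | nil =>
    cases hL
    exact ⟨[], _, .nil _ _ _, hp⟩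
  | cons t L ih =>
    obtain ⟨rfl, hL⟩ := hL
    have hm' := fun s hs => hm s (List.mem_cons_of_mem t hs)
    rcases (mem_multiAut_trans C).1 (hm t List.mem_cons_self) with
      ⟨q, a, z, q', i, h, hi, rfl⟩ | ⟨q, q', i, h, hi, rfl⟩ |
      ⟨q, a, z, q', i, D, s, h, hi, rfl⟩ | ⟨q, i, z, D, s, h, hi, rfl⟩
    · obtain ⟨E, u, hE, hle⟩ := ih hL hm' hp _
      exact ⟨E, _, .read a z hi.1 h hE, hle⟩
    · obtain ⟨E, u, hE, hle⟩ := ih hL hm' hp pos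
      exact ⟨E, u, .eps hi.1 h hE, hle⟩
    · obtain ⟨E, u, hE, hle⟩ := ih hL hm' (Nat.succ_le_succ hi.2) _
      exact ⟨_, _, .mis a z D s hi.1 h hE, (Nat.add_right_comm _ _ _).trans_le hle⟩
    · obtain ⟨E, u, hE, hle⟩ := ih hL hm' (Nat.succ_le_succ hi.2) pos
      exact ⟨_, u, .cop z D s hi.1 h hE, (Nat.add_right_comm _ _ _).trans_le hle⟩

theorem MRun.isWalk {L : List (((Σ x, Q x) × ℕ) × Finset (Tag A X n) × ((Σ x, Q x) × ℕ))}
    {i : ℕ} {pos : X → ℕ} {q r : Σ x, Q x} {E : List (Sample A X n)} {u : X → List A}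
    (h : MRun (conAut C) i pos q L E u r) (hle : i + E.length ≤ 2 * n + 1) :
    IsWalk (q, i) L (r, i + E.length) ∧ ∀ t ∈ L, t ∈ (multiAut C).trans := by
  induction h with
  | nil => exact ⟨rfl, by simp⟩
  | read a z hi ht _ ih =>
    obtain ⟨hwalk, hmem⟩ := ih hle
    exact ⟨⟨rfl, hwalk⟩, List.forall_mem_cons.2 ⟨(mem_multiAut_trans C).2
      (Or.inl ⟨_, a, z, _, _, ht, ⟨hi, by lia⟩, rfl⟩), hmem⟩⟩
  | eps hi ht _ ih =>
    obtain ⟨hwalk, hmem⟩ := ih hle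
    exact ⟨⟨rfl, hwalk⟩, List.forall_mem_cons.2 ⟨(mem_multiAut_trans C).2
      (Or.inr (Or.inl ⟨_, _, _, ht, ⟨hi, by lia⟩, rfl⟩)), hmem⟩⟩
  | mis a z D s hi ht _ ih =>
    rw [List.length_cons] at hle ⊢
    obtain ⟨hwalk, hmem⟩ := ih (by lia)
    rw [add_assoc, add_comm 1] at hwalk
    exact ⟨⟨rfl, hwalk⟩, List.forall_mem_cons.2 ⟨(mem_multiAut_trans C).2
      (Or.inr (Or.inr (Or.inl ⟨_, a, z, _, _, D, s, ht, ⟨hi, by lia⟩, rfl⟩))), hmem⟩⟩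
  | cop z D s hi ht _ ih =>
    rw [List.length_cons] at hle ⊢
    obtain ⟨hwalk, hmem⟩ := ih (by lia)
    rw [add_assoc, add_comm 1] at hwalk
    exact ⟨⟨rfl, hwalk⟩, List.forall_mem_cons.2 ⟨(mem_multiAut_trans C).2
      (Or.inr (Or.inr (Or.inr ⟨_, _, z, D, s, ht, ⟨hi, by lia⟩, rfl⟩))), hmem⟩⟩

theorem mem_conAut_states (s : Σ x, Q x) : s ∈ (conAut C).states :=
  (mem_concatVars_states C).2 ((Finset.mem_sort _).2 (Finset.mem_univ s.1))

theorem wellFormed_multiAut : (multiAut C).WellFormed := by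
  have mem_states : ∀ {q : Σ x, Q x} {i : ℕ}, 1 ≤ i → i ≤ 2 * n + 1 →
      (q, i) ∈ (multiAut C).states := fun h1 h2 =>
    Finset.mem_product.2 ⟨mem_conAut_states C _, Finset.mem_Icc.2 ⟨h1, h2⟩⟩
  refine ⟨fun t ht => ?_, fun t ht => ?_, fun q hq => ?_, fun q hq => ?_⟩
  · rcases (mem_multiAut_trans C).1 ht with ⟨_, _, _, _, _, _, _, rfl⟩ | ⟨_, _, _, _, _, rfl⟩ |
      ⟨_, _, _, _, _, _, _, _, _, rfl⟩ | ⟨_, _, _, _, _, _, _, rfl⟩ <;>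
      exact mem_states (by lia) (by lia)
  · rcases (mem_multiAut_trans C).1 ht with ⟨_, _, _, _, _, _, _, rfl⟩ | ⟨_, _, _, _, _, rfl⟩ |
      ⟨_, _, _, _, _, _, _, _, _, rfl⟩ | ⟨_, _, _, _, _, _, _, rfl⟩ <;>
      exact mem_states (by lia) (by lia)
  · have hq2 := Finset.mem_singleton.1 (Finset.mem_product.1 hq).2
    exact mem_states (by lia) (by lia)
  · obtain ⟨h1, h2⟩ := Finset.mem_Icc.1 (Finset.mem_filter.1 (Finset.mem_product.1 hq).2).1
    exact mem_states h1 h2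

end MultiAut

end MultiDiseq

/-! ### The values of the formula on a run -/

namespace MultiDiseq

open TagAut (tagCount)

variable {A : Type uA} {X : Type uX} {n : ℕ} {S : Type*}

open scoped Classical in
/-- The counters of lengths, samples and positions have the values determined by a run that
samples `E` and reads `u`; the samples satisfy what holds on every such run. -/
structure Represents (σ : MVar A X S n → ℤ) (E : List (Sample A X n)) (u : X → List A) :
    Prop where
  length_le : E.length ≤ 2 * n
  letter_ne_none : ∀ e ∈ E[0]?, e.letter ≠ none
  getElem?_var_eq_letter : ∀ e ∈ E, ∀ a, e.letter = some a → (u e.var)[e.pos e.var]? = some a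
  eval_len : ∀ x, σ (.parikh (.tag (.len x))) = (u x).length
  eval_tag : ∀ k < 2 * n, ∀ e : Sample A X n, σ (.parikh (.tag (e.tag (k + 1)))) =
    if ∃ e' ∈ E[k]?, e.tag (k + 1) = e'.tag (k + 1) then 1 else 0
  sum_eval_pos : ∀ (k : ℕ), ∀ e ∈ E[k]?, ∀ v,
    ∑ j ∈ Finset.Icc 1 (k + 1), σ (.parikh (.tag (.pos j v))) = e.pos v

theorem represents_of_mRun [Fintype A] [Fintype X] {M : TagAut (Tag A X n) S} {q r : S}
    {L : List ((S × ℕ) × Finset (Tag A X n) × (S × ℕ))} {E : List (Sample A X n)}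
    {u : X → List A} {σ : MVar A X (S × ℕ) n → ℤ} (h : MRun M 1 0 q L E u r)
    (hE : E.length ≤ 2 * n)
    (hσ : ∀ τ ∈ allTags A X n, σ (.parikh (.tag τ)) = tagCount τ L) : Represents σ E u where
  length_le := hE
  letter_ne_none e he := h.letter_ne_none he
  getElem?_var_eq_letter e he a ha := h.getElem?_var_eq_letter (fun x => by simp) he ha
  eval_len x := by
    rw [hσ _ (by simp [allTags]), h.tagCount_len]
  eval_tag k hk e := by
    have he : e.tag (k + 1) ∈ allTags A X n := by
      obtain ⟨x, D, s, _ | a, pos⟩ := e <;> simp [allTags] <;> lia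
    rw [hσ _ he, add_comm k, h.tagCount_tag]
    simp
  sum_eval_pos k e he v := by
    have hk := (List.getElem?_eq_some_iff.1 he).1
    rw [← h.sum_tagCount_pos le_rfl v he, Pi.zero_apply, zero_add, Nat.cast_sum, add_comm 1 k]
    refine Finset.sum_congr rfl fun j hj => hσ _ ?_
    rw [Finset.mem_Icc] at hj
    simp only [allTags, Finset.mem_union, Finset.mem_image, Finset.mem_product, Finset.mem_Icc]
    exact Or.inr ⟨(j, v), ⟨⟨hj.1, by lia⟩, Finset.mem_univ v⟩, rfl⟩

/-- The side of the disequality that a sample is taken for. -/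
def Sample.key (e : Sample A X n) : Fin n × Side := (e.diseq, e.side)

/-- The sample `e'` may come immediately after `e`: if it is a copy, then no letter of its
variable is read between the letter sampled by `e` and itself. -/
def Sample.Precedes (e e' : Sample A X n) : Prop :=
  e'.letter = none → e.var = e'.var ∧ e'.pos e.var = e.pos e.var + if e.letter = none then 0 else 1

namespace Represents

variable {σ : MVar A X S n → ℤ} {E : List (Sample A X n)} {u : X → List A} {k : ℕ}

theorem lt_of_mem_getElem? (h : Represents σ E u) {e : Sample A X n} (he : e ∈ E[k]?) :
    k < 2 * n :=
  (List.getElem?_eq_some_iff.1 he).1.trans_le h.length_le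

theorem eval_lenTerm (h : Represents σ E u) (l : List X) :
    (lenTerm (A := A) (S := S) (n := n) l).eval σ = (DiseqConstraint.word u l).length := by
  rw [lenTerm, LTerm.eval_listSum, List.map_map, DiseqConstraint.word, List.length_flatten,
    List.map_map, Nat.cast_list_sum, List.map_map]
  exact congrArg List.sum (List.map_congr_left fun x _ => h.eval_len x)

theorem eval_posSum (h : Represents σ E u) {e : Sample A X n} (he : e ∈ E[k]?) (v : X) :
    (posSum (A := A) (S := S) (n := n) (k + 1) v).eval σ = e.pos v := by
  rw [posSum, LTerm.eval_sum]
  exact h.sum_eval_pos k e he v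

theorem eval_cnt_pos (h : Represents σ E u) {e e' : Sample A X n} (he : e ∈ E[k]?)
    (he' : e' ∈ E[k + 1]?) (v : X) :
    (cnt (S := S) (.pos (A := A) (n := n) (k + 2) v)).eval σ = e'.pos v - e.pos v := by
  rw [← h.sum_eval_pos _ e he v, ← h.sum_eval_pos _ e' he' v,
    Finset.sum_Icc_succ_top (Nat.le_add_left 1 (k + 1)), add_sub_cancel_left]
  rfl

open scoped Classical in
theorem eval_cnt_mis (h : Represents σ E u) (hk : k < 2 * n) (x : X) (D : Fin n) (s : Side)
    (a : A) : (cnt (S := S) (.mis (k + 1) x D s a)).eval σ =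
      if ∃ e ∈ E[k]?, e.var = x ∧ e.diseq = D ∧ e.side = s ∧ e.letter = some a then 1 else 0 := by
  simpa [cnt, LTerm.eval, @eq_comm _ (Tag.mis _ _ _ _ _)] using h.eval_tag k hk ⟨x, D, s, some a, 0⟩

open scoped Classical in
theorem eval_cnt_cop (h : Represents σ E u) (hk : k < 2 * n) (x : X) (D : Fin n) (s : Side) :
    (cnt (S := S) (.cop (A := A) (k + 1) x D s)).eval σ =
      if ∃ e ∈ E[k]?, e.var = x ∧ e.diseq = D ∧ e.side = s ∧ e.letter = none then 1 else 0 := by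
  simpa [cnt, LTerm.eval, @eq_comm _ (Tag.cop _ _ _ _)] using h.eval_tag k hk ⟨x, D, s, none, 0⟩

open scoped Classical in
theorem eval_misCount [Fintype A] (h : Represents σ E u) (hk : k < 2 * n) (x : X) (D : Fin n)
    (s : Side) : (misCount (A := A) (S := S) (k + 1) x D s).eval σ =
      if ∃ e ∈ E[k]?, e.var = x ∧ e.diseq = D ∧ e.side = s ∧ e.letter ≠ none then 1 else 0 := by
  rw [misCount, LTerm.eval_sum, Finset.sum_congr rfl fun a _ => h.eval_cnt_mis hk x D s a,
    Finset.sum_ite_zero _ _ (by aesop)]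
  refine if_congr ?_ rfl rfl
  cases E[k]? <;> simp [Option.ne_none_iff_exists']

open scoped Classical in
theorem eval_misCount_add_cnt_cop [Fintype A] (h : Represents σ E u) (hk : k < 2 * n) (x : X)
    (D : Fin n) (s : Side) :
    (misCount (A := A) (S := S) (k + 1) x D s).eval σ +
        (cnt (S := S) (.cop (A := A) (k + 1) x D s)).eval σ =
      if ∃ e ∈ E[k]?, e.var = x ∧ e.diseq = D ∧ e.side = s then 1 else 0 := by
  rw [h.eval_misCount hk, h.eval_cnt_cop hk]
  rcases E[k]? with _ | e
  · simp
  · cases hl : e.letter <;> simp [hl]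

open scoped Classical in
theorem eval_misTotal [Fintype A] (h : Represents σ E u) (hk : k < 2 * n) (x : X) :
    (misTotal (A := A) (S := S) (n := n) (k + 1) x).eval σ =
      if ∃ e ∈ E[k]?, e.var = x ∧ e.letter ≠ none then 1 else 0 := by
  rw [misTotal, LTerm.eval_sum, Finset.sum_congr rfl fun d _ => h.eval_misCount hk x d.1 d.2,
    Finset.sum_ite_zero _ _ (by aesop)]
  refine if_congr ?_ rfl rfl
  cases E[k]? <;> simp

open scoped Classical in
theorem eval_copTotal (h : Represents σ E u) (hk : k < 2 * n) (x : X) :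
    (copTotal (A := A) (S := S) (n := n) (k + 1) x).eval σ =
      if ∃ e ∈ E[k]?, e.var = x ∧ e.letter = none then 1 else 0 := by
  rw [copTotal, LTerm.eval_sum, Finset.sum_congr rfl fun d _ => h.eval_cnt_cop hk x d.1 d.2,
    Finset.sum_ite_zero _ _ (by aesop)]
  refine if_congr ?_ rfl rfl
  cases E[k]? <;> simp

open scoped Classical in
theorem eval_sum_cnt_mis [Fintype X] (h : Represents σ E u) (hk : k < 2 * n) (D : Fin n)
    (s : Side) (a : A) :
    (LTerm.sum (Finset.univ : Finset X) fun x => cnt (S := S) (.mis (k + 1) x D s a)).eval σ =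
      if ∃ e ∈ E[k]?, e.diseq = D ∧ e.side = s ∧ e.letter = some a then 1 else 0 := by
  rw [LTerm.eval_sum, Finset.sum_congr rfl fun x _ => h.eval_cnt_mis hk x D s a,
    Finset.sum_ite_zero _ _ (by aesop)]
  refine if_congr ?_ rfl rfl
  cases E[k]? <;> simp

open scoped Classical in
theorem eval_sum_cnt_cop [Fintype X] (h : Represents σ E u) (hk : k < 2 * n) (D : Fin n)
    (s : Side) :
    (LTerm.sum (Finset.univ : Finset X) fun x =>
      cnt (S := S) (.cop (A := A) (k + 1) x D s)).eval σ =
      if ∃ e ∈ E[k]?, e.diseq = D ∧ e.side = s ∧ e.letter = none then 1 else 0 := by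
  rw [LTerm.eval_sum, Finset.sum_congr rfl fun x _ => h.eval_cnt_cop hk x D s,
    Finset.sum_ite_zero _ _ (by aesop)]
  refine if_congr ?_ rfl rfl
  cases E[k]? <;> simp

theorem eval_copies_iff_precedes [Fintype A] (h : Represents σ E u) {e e' : Sample A X n}
    (he : e ∈ E[k]?) (he' : e' ∈ E[k + 1]?) :
    (∀ x, ((misTotal (S := S) (k + 1) x).eval σ + (copTotal (S := S) (k + 1) x).eval σ = 0 →
          (copTotal (S := S) (k + 2) x).eval σ = 0) ∧
        ((copTotal (S := S) (k + 2) x).eval σ = 1 →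
          (cnt (S := S) (.pos (A := A) (n := n) (k + 2) x)).eval σ -
            (misTotal (S := S) (k + 1) x).eval σ = 0)) ↔ e.Precedes e' := by
  classical
  have hk' : k + 1 < 2 * n := h.lt_of_mem_getElem? he'
  have hk : k < 2 * n := by lia
  simp only [h.eval_misTotal hk, h.eval_copTotal hk, h.eval_copTotal hk', h.eval_cnt_pos he he']
  rw [Option.mem_def] at he he'
  simp only [he, he', Option.mem_some, exists_eq_left', Sample.Precedes]
  refine ⟨fun H => ?_, fun H x => ?_⟩
  · specialize H e'.var
    grind
  · grind

theorem holds_copies_iff [Fintype A] [Fintype X] (h : Represents σ E u) :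
    (copiesFormula A X S n).Holds σ ↔ E.IsChain Sample.Precedes := by
  simp only [copiesFormula, LIA.Holds, LIA.holds_conj, Finset.mem_product, Finset.mem_univ,
    and_true, Finset.mem_Ico, Finset.mem_Icc, Prod.forall, LTerm.eval, List.isChain_iff_getElem]
  refine ⟨fun ⟨hcop, hpos⟩ k hk => ?_, fun hE => ?_⟩
  · have := h.length_le
    exact (h.eval_copies_iff_precedes (List.getElem?_eq_getElem _)
      (List.getElem?_eq_getElem hk)).1 fun x =>
        ⟨hcop (k + 1) x (by lia), hpos (k + 2) x (by lia)⟩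
  · have key (k : ℕ) (hk : k + 1 < 2 * n) (x : X) :
        ((misTotal (S := S) (k + 1) x).eval σ + (copTotal (S := S) (k + 1) x).eval σ = 0 →
          (copTotal (S := S) (k + 2) x).eval σ = 0) ∧
        ((copTotal (S := S) (k + 2) x).eval σ = 1 →
          (cnt (S := S) (.pos (A := A) (n := n) (k + 2) x)).eval σ -
            (misTotal (S := S) (k + 1) x).eval σ = 0) := by
      by_cases hkE : k + 1 < E.length
      · exact (h.eval_copies_iff_precedes (List.getElem?_eq_getElem _)
          (List.getElem?_eq_getElem hkE)).2 (hE k hkE) x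
      · simp [h.eval_copTotal hk, List.getElem?_eq_none (not_lt.1 hkE)]
    refine ⟨fun i x hi => ?_, fun i x hi => ?_⟩
    · obtain ⟨k, rfl⟩ := Nat.exists_eq_add_of_le' hi.1
      exact (key k hi.2 x).1
    · obtain ⟨k, rfl⟩ := Nat.exists_eq_add_of_le' hi.1
      exact (key k hi.2 x).2

theorem holds_consist_iff [Fintype A] [Fintype X] (h : Represents σ E u) :
    (consistFormula A X S n).Holds σ ↔ ∀ (k : ℕ), ∀ e ∈ E[k]?,
      σ (.shared (k + 1)) = σ (.misSym e.diseq e.side) ∧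
      (∀ a, e.letter = some a → σ (.misSym e.diseq e.side) = (Fintype.equivFin A a : ℕ)) ∧
      (e.letter = none → σ (.misSym e.diseq e.side) = σ (.shared k)) := by
  classical
  simp only [consistFormula, LIA.Holds, LIA.holds_conj, Finset.mem_product, Finset.mem_univ,
    true_and, Finset.mem_Icc, Prod.forall, sharedVar, symVar, code, LTerm.eval]
  refine ⟨fun H k e he => ?_, fun H D s a i hi => ?_⟩
  · have hk := h.lt_of_mem_getElem? he
    obtain ⟨a₀⟩ : Nonempty A := by
      have h0 : 0 < E.length := (Nat.zero_le k).trans_lt (List.getElem?_eq_some_iff.1 he).1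
      have hl := h.letter_ne_none _ (List.getElem?_eq_getElem h0)
      exact ⟨(Option.ne_none_iff_exists'.1 hl).choose⟩
    have key (a : A) := H e.diseq e.side a (k + 1) ⟨by lia, hk⟩
    simp only [h.eval_sum_cnt_mis hk, h.eval_sum_cnt_cop hk, ite_eq_left_iff, zero_ne_one,
      imp_false, not_not] at key
    refine ⟨?_, fun a ha => ((key a).1 ⟨e, he, rfl, rfl, ha⟩).2,
      fun hl => ((key a₀).2 ⟨e, he, rfl, rfl, hl⟩).2⟩
    cases hl : e.letter with
    | none => exact ((key a₀).2 ⟨e, he, rfl, rfl, hl⟩).1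
    | some a => exact ((key a).1 ⟨e, he, rfl, rfl, hl⟩).1
  · obtain ⟨k, rfl⟩ := Nat.exists_eq_add_of_le' hi.1
    simp only [h.eval_sum_cnt_mis hi.2, h.eval_sum_cnt_cop hi.2, ite_eq_left_iff, zero_ne_one,
      imp_false, not_not]
    refine ⟨?_, ?_⟩
    · rintro ⟨e, he, rfl, rfl, hl⟩
      exact ⟨(H k e he).1, (H k e he).2.1 a hl⟩
    · rintro ⟨e, he, rfl, rfl, hl⟩
      exact ⟨(H k e he).1, (H k e he).2.2 hl⟩

theorem holds_pos_iff [Fintype A] (h : Represents σ E u) (D : Fin n) (s : Side) (v : X) :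
    (posFormula (A := A) (S := S) D s v).Holds σ ↔ ∀ e ∈ E, e.var = v → e.diseq = D →
      e.side = s → σ (.misPos D s) = e.pos v - if e.letter = none then 1 else 0 := by
  classical
  have ite_pos_iff (P : Prop) [Decidable P] : (0 : ℤ) < (if P then 1 else 0) ↔ P := by
    split_ifs with hP <;> simp [hP]
  simp only [posFormula, LIA.Holds, LIA.holds_conj, LIA.holds_lt, Finset.mem_Icc, posVar,
    LTerm.eval]
  refine ⟨fun ⟨hmis, hcop⟩ e he hv hD hs => ?_, fun H => ⟨fun i hi => ?_, fun i hi => ?_⟩⟩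
  · obtain ⟨k, he⟩ := List.mem_iff_getElem?.1 he
    have hk := h.lt_of_mem_getElem? he
    split_ifs with hl
    · have hk0 : k ≠ 0 := by
        rintro rfl
        exact h.letter_ne_none e he hl
      have := hcop (k + 1) (by lia)
      rw [h.eval_cnt_cop hk, ite_pos_iff, h.eval_posSum he] at this
      exact this ⟨e, he, hv, hD, hs, hl⟩
    · have := hmis (k + 1) (by lia)
      rw [h.eval_misCount hk, ite_pos_iff, h.eval_posSum he] at this
      rw [sub_zero]
      exact this ⟨e, he, hv, hD, hs, hl⟩
  · obtain ⟨k, rfl⟩ := Nat.exists_eq_add_of_le' hi.1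
    rw [h.eval_misCount hi.2, ite_pos_iff]
    rintro ⟨e, he, hv, hD, hs, hl⟩
    rw [h.eval_posSum he, H e (List.mem_of_getElem? he) hv hD hs, if_neg hl, sub_zero]
  · obtain ⟨k, rfl⟩ := Nat.exists_eq_add_of_le' (Nat.one_le_of_lt hi.1)
    rw [h.eval_cnt_cop hi.2, ite_pos_iff]
    rintro ⟨e, he, hv, hD, hs, hl⟩
    rw [h.eval_posSum he, H e (List.mem_of_getElem? he) hv hD hs, if_pos hl]

theorem sum_add_pos_iff [Fintype A] (h : Represents σ E u) (D : Fin n) (s : Side) (v : X) :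
    0 < ∑ i ∈ Finset.Icc 1 (2 * n), ((misCount (A := A) (S := S) i v D s).eval σ +
        (cnt (S := S) (.cop (A := A) i v D s)).eval σ) ↔
      ∃ e ∈ E, e.var = v ∧ e.diseq = D ∧ e.side = s := by
  classical
  rw [Finset.sum_pos_iff_of_nonneg fun i hi => ?nonneg]
  case nonneg =>
    obtain ⟨k, rfl⟩ := Nat.exists_eq_add_of_le' (Finset.mem_Icc.1 hi).1
    rw [h.eval_misCount_add_cnt_cop (Finset.mem_Icc.1 hi).2]
    split_ifs <;> simp
  constructor
  · rintro ⟨i, hi, hpos⟩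
    obtain ⟨k, rfl⟩ := Nat.exists_eq_add_of_le' (Finset.mem_Icc.1 hi).1
    rw [h.eval_misCount_add_cnt_cop (Finset.mem_Icc.1 hi).2] at hpos
    split_ifs at hpos with he
    · obtain ⟨e, he, hv⟩ := he
      exact ⟨e, List.mem_of_getElem? he, hv⟩
    · exact absurd hpos (lt_irrefl 0)
  · rintro ⟨e, he, hv⟩
    obtain ⟨k, he⟩ := List.mem_iff_getElem?.1 he
    have hk := h.lt_of_mem_getElem? he
    refine ⟨k + 1, Finset.mem_Icc.2 ⟨Nat.le_add_left 1 k, hk⟩, ?_⟩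
    rw [h.eval_misCount_add_cnt_cop hk, if_pos ⟨e, he, hv⟩]
    exact one_pos

theorem holds_present_iff [Fintype A] (h : Represents σ E u) (D : Fin n) (s : Side) (v : X) :
    (presentFormula (A := A) (S := S) D s v).Holds σ ↔
      ∃ e ∈ E, e.var = v ∧ e.diseq = D ∧ e.side = s := by
  classical
  have hn : 1 ≤ 2 * n := Nat.mul_pos two_pos D.pos
  have no_copy : (cnt (S := S) (.cop (A := A) 1 v D s)).eval σ = 0 := by
    rw [h.eval_cnt_cop hn, if_neg]
    rintro ⟨e, he, -, -, -, hl⟩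
    exact h.letter_ne_none e he hl
  rw [← h.sum_add_pos_iff, ← Finset.add_sum_Ioc_eq_sum_Icc hn, no_copy, add_zero, presentFormula,
    LIA.holds_lt]
  simp only [LTerm.eval, LTerm.eval_sum]
  rfl

theorem holds_fair [Fintype A] [Fintype X] (h : Represents σ E u)
    (hE : (E.map Sample.key).Nodup) : (fairFormula A X S n).Holds σ := by
  classical
  simp only [fairFormula, LIA.Holds, LIA.holds_conj, Finset.mem_univ, true_imp_iff, Prod.forall,
    LTerm.eval, LTerm.eval_sum]
  intro D s
  let sampled (d : ℕ × X) : Prop := ∃ e ∈ E[d.1 - 1]?, e.var = d.2 ∧ e.diseq = D ∧ e.side = s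
  have value : ∀ d ∈ Finset.Icc 1 (2 * n) ×ˢ (Finset.univ : Finset X),
      (misCount (A := A) (S := S) d.1 d.2 D s).eval σ +
        (cnt (S := S) (.cop (A := A) d.1 d.2 D s)).eval σ = if sampled d then 1 else 0 := by
    rintro ⟨i, x⟩ hi
    have hi := Finset.mem_Icc.1 (Finset.mem_product.1 hi).1
    obtain ⟨k, rfl⟩ := Nat.exists_eq_add_of_le' hi.1
    exact (h.eval_misCount_add_cnt_cop hi.2 x D s).trans (if_congr Iff.rfl rfl rfl)
  rw [Finset.sum_congr rfl value, Finset.sum_ite_zero]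
  · split_ifs <;> simp
  · rintro ⟨i, x⟩ hi ⟨j, y⟩ hj ⟨e, he, rfl, rfl, rfl⟩ ⟨e', he', rfl, hD, hs⟩
    have hi := Finset.mem_Icc.1 (Finset.mem_product.1 hi).1
    have hj := Finset.mem_Icc.1 (Finset.mem_product.1 hj).1
    have hij : i - 1 = j - 1 := by
      have hlt := (List.getElem?_eq_some_iff.1 he).1
      refine (List.getElem?_inj (by rwa [List.length_map]) hE).1 ?_
      rw [List.getElem?_map, List.getElem?_map, he, he', Option.map_some, Option.map_some,
        Sample.key, Sample.key, hD, hs]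
    obtain rfl : i = j := by lia
    rw [he] at he'
    obtain rfl := Option.some_inj.1 he'
    rfl

/-- Going back through the copies leads to a sample that reads a letter. -/
theorem exists_letter [Fintype A] [Fintype X] (h : Represents σ E u)
    (hE : E.IsChain Sample.Precedes) (hσ : (consistFormula A X S n).Holds σ) {k : ℕ}
    {e : Sample A X n} (he : e ∈ E[k]?) : ∃ (a : A) (p : ℕ), (u e.var)[p]? = some a ∧
      σ (.misSym e.diseq e.side) = (Fintype.equivFin A a : ℕ) ∧
      e.pos e.var = p + if e.letter = none then 1 else 0 := by
  rw [h.holds_consist_iff] at hσ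
  induction k generalizing e with
  | zero =>
    obtain ⟨a, ha⟩ := Option.ne_none_iff_exists'.1 (h.letter_ne_none e he)
    exact ⟨a, e.pos e.var, h.getElem?_var_eq_letter e (List.mem_of_getElem? he) a ha,
      (hσ 0 e he).2.1 a ha, by simp [ha]⟩
  | succ k ih =>
    obtain ⟨-, hread, hcopy⟩ := hσ (k + 1) e he
    cases hl : e.letter with
    | some a =>
      exact ⟨a, e.pos e.var, h.getElem?_var_eq_letter e (List.mem_of_getElem? he) a hl,
        hread a hl, rfl⟩
    | none =>
      obtain ⟨hk, rfl⟩ := List.getElem?_eq_some_iff.1 he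
      have he₀ := List.getElem?_eq_getElem (Nat.lt_of_succ_lt hk)
      obtain ⟨hvar, hpos⟩ := List.isChain_iff_getElem.1 hE k hk hl
      obtain ⟨a, p, hp, ha, hp'⟩ := ih he₀
      refine ⟨a, p, hvar ▸ hp, by rw [hcopy hl, (hσ k _ he₀).1, ha], ?_⟩
      rw [← hvar, hpos, hp', if_pos rfl]
      split_ifs <;> rfl

end Represents

theorem getElem?_word (u : X → List A) (l : List X) (g : ℕ) (a : A) :
    (DiseqConstraint.word u l)[g]? = some a ↔ ∃ (i : Fin l.length) (p : ℕ),
      (u (l.get i))[p]? = some a ∧ g = (DiseqConstraint.word u (l.take i)).length + p := by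
  induction l generalizing g with
  | nil => simp [DiseqConstraint.word]
  | cons x l ih =>
    have word_cons l : DiseqConstraint.word u (x :: l) = u x ++ DiseqConstraint.word u l := by
      simp [DiseqConstraint.word]
    have word_nil : DiseqConstraint.word u [] = [] := rfl
    rw [word_cons, List.getElem?_append]
    constructor
    · split_ifs with hg <;> intro ha
      · exact ⟨⟨0, by simp⟩, g, ha, by simp [word_nil]⟩
      · obtain ⟨i, p, hp, hi⟩ := (ih _).1 ha
        refine ⟨i.succ, p, hp, ?_⟩
        rw [Fin.val_succ, List.take_succ_cons, word_cons, List.length_append]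
        lia
    · rintro ⟨i, p, hp, rfl⟩
      cases i using Fin.cases with
      | zero =>
        have : p < (u x).length := (List.getElem?_eq_some_iff.1 hp).1
        simpa [word_nil, this] using hp
      | succ i =>
        rw [Fin.val_succ, List.take_succ_cons, word_cons, List.length_append, if_neg (by lia)]
        exact (ih _).2 ⟨i, p, hp, by lia⟩

end MultiDiseq

/-! ### From models to words -/

namespace MultiDiseq

variable {A : Type uA} {X : Type uX} {Q : X → Type uQ} {I : Type uI} {n : ℕ}

/-- Two different letters stand at the same global position of the concatenations `l` and `r`:
one at position `p` of the `i`-th factor of `l`, the other at position `q` of the `j`-th factor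
of `r`. -/
def IsMismatch (w : X → List A) (l r : List X) (i : Fin l.length) (j : Fin r.length) (p q : ℕ) :
    Prop :=
  (∃ a b, (w (l.get i))[p]? = some a ∧ (w (r.get j))[q]? = some b ∧ a ≠ b) ∧
    (DiseqConstraint.word w (l.take i)).length + p = (DiseqConstraint.word w (r.take j)).length + q

theorem word_ne_word_iff {w : X → List A} {l r : List X} :
    DiseqConstraint.word w l ≠ DiseqConstraint.word w r ↔
      (DiseqConstraint.word w l).length ≠ (DiseqConstraint.word w r).length ∨
      ∃ i j p q, IsMismatch w l r i j p q := by
  constructor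
  · refine fun hne => or_iff_not_imp_left.2 fun hlen => ?_
    rw [not_ne_iff] at hlen
    obtain ⟨g, hl, hr, hg⟩ : ∃ (g : ℕ) (hl : g < (DiseqConstraint.word w l).length)
        (hr : g < (DiseqConstraint.word w r).length),
        (DiseqConstraint.word w l)[g] ≠ (DiseqConstraint.word w r)[g] := by
      by_contra! H
      exact hne (List.ext_getElem hlen H)
    obtain ⟨i, p, hp, hgp⟩ := (getElem?_word w l g _).1 (List.getElem?_eq_getElem hl)
    obtain ⟨j, q, hq, hgq⟩ := (getElem?_word w r g _).1 (List.getElem?_eq_getElem hr)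
    exact ⟨i, j, p, q, ⟨_, _, hp, hq, hg⟩, hgp.symm.trans hgq⟩
  · rintro (hlen | ⟨i, j, p, q, ⟨a, b, ha, hb, hab⟩, hg⟩) heq
    · exact hlen (congrArg List.length heq)
    · have hl := (getElem?_word w l _ a).2 ⟨i, p, ha, rfl⟩
      have hr := (getElem?_word w r _ b).2 ⟨j, q, hb, rfl⟩
      rw [heq, hg, hr] at hl
      exact hab (Option.some_inj.1 hl).symm

namespace Represents

variable {S : Type*} {σ : MVar A X S n → ℤ} {E : List (Sample A X n)} {w : X → List A}
  {D : Fin n}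

theorem holds_lenFormula_iff (h : Represents σ E w) (l r : List X) :
    (lenFormula (A := A) (S := S) (n := n) l r).Holds σ ↔
      (DiseqConstraint.word w l).length ≠ (DiseqConstraint.word w r).length := by
  rw [lenFormula, LIA.holds_ne, h.eval_lenTerm, h.eval_lenTerm, Nat.cast_inj.ne]

theorem exists_letter_of_holds_pos [Fintype A] [Fintype X] (h : Represents σ E w)
    (hE : E.IsChain Sample.Precedes) (hσ : (consistFormula A X S n).Holds σ) {s : Side} {v : X}
    (hpos : (posFormula (A := A) (S := S) D s v).Holds σ)
    (hpresent : (presentFormula (A := A) (S := S) D s v).Holds σ) :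
    ∃ (a : A) (p : ℕ), (w v)[p]? = some a ∧
      σ (.misSym D s) = (Fintype.equivFin A a : ℕ) ∧ σ (.misPos D s) = p := by
  obtain ⟨e, he, rfl, rfl, rfl⟩ := (h.holds_present_iff D s v).1 hpresent
  obtain ⟨k, hk⟩ := List.mem_iff_getElem?.1 he
  obtain ⟨a, p, hp, ha, hep⟩ := h.exists_letter hE hσ hk
  refine ⟨a, p, hp, ha, ?_⟩
  rw [(h.holds_pos_iff _ _ _).1 hpos e he rfl rfl rfl, hep]
  split_ifs <;> simp

theorem exists_isMismatch_of_holds [Fintype A] [Fintype X] (h : Represents σ E w)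
    (hE : E.IsChain Sample.Precedes) (hσ : (consistFormula A X S n).Holds σ) {l r : List X}
    (hmis : (misFormula (A := A) (S := S) D l r).Holds σ)
    (hsym : (symFormula (A := A) (X := X) (S := S) D).Holds σ) :
    ∃ i j p q, IsMismatch w l r i j p q := by
  simp only [misFormula, LIA.holds_disj, Finset.mem_univ, true_and, LIA.Holds, alignFormula,
    LTerm.eval, h.eval_lenTerm, posVar] at hmis
  obtain ⟨⟨i, j⟩, hposl, hposr, halign, hpresentl, hpresentr⟩ := hmis
  obtain ⟨a, p, hp, ha, hσp⟩ := h.exists_letter_of_holds_pos hE hσ hposl hpresentl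
  obtain ⟨b, q, hq, hb, hσq⟩ := h.exists_letter_of_holds_pos hE hσ hposr hpresentr
  rw [symFormula, LIA.holds_ne] at hsym
  refine ⟨i, j, p, q, ⟨a, b, hp, hq, ?_⟩, ?_⟩
  · rintro rfl
    exact hsym (ha.trans hb.symm)
  · rw [hσp, hσq] at halign
    exact_mod_cast halign

end Represents

section

variable [Fintype A] [Fintype X] [LinearOrder X] [∀ x, Fintype (Q x)]
  (C : DiseqConstraint A X Q I n)

theorem holds_formula_iff (σ : MVar A X ((Σ x, Q x) × ℕ) n → ℤ) :
    (formula C).Holds σ ↔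
      ((multiAut C).parikhTagFormula (allTags A X n)).Holds (σ ∘ MVar.parikh) ∧
      (fairFormula A X ((Σ x, Q x) × ℕ) n).Holds σ ∧
      (consistFormula A X ((Σ x, Q x) × ℕ) n).Holds σ ∧
      (copiesFormula A X ((Σ x, Q x) × ℕ) n).Holds σ ∧
      ∀ D, (lenFormula (A := A) (S := (Σ x, Q x) × ℕ) (n := n) (C.lhs D) (C.rhs D)).Holds σ ∨
        (misFormula (A := A) (S := (Σ x, Q x) × ℕ) D (C.lhs D) (C.rhs D)).Holds σ ∧
        (symFormula (A := A) (X := X) (S := (Σ x, Q x) × ℕ) D).Holds σ := by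
  simp only [formula, LIA.Holds, LIA.holds_rename, LIA.holds_conj, Finset.mem_univ, true_imp_iff]

theorem exists_words_of_holds [Nonempty X] {σ : MVar A X ((Σ x, Q x) × ℕ) n → ℤ}
    (h : (formula C).Holds σ) :
    ∃ w : X → List A, (∀ x, w x ∈ (C.nfa x).accepts) ∧
      ∀ D, DiseqConstraint.word w (C.lhs D) ≠ DiseqConstraint.word w (C.rhs D) := by
  obtain ⟨hparikh, -, hconsist, hcopies, hdiseq⟩ := (holds_formula_iff C σ).1 h
  obtain ⟨⟨q, i⟩, L, ⟨r, j⟩, hL, htag⟩ :=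
    TagAut.exists_run_of_holds (wellFormed_multiAut C) hparikh
  obtain ⟨hq, hi⟩ := Finset.mem_product.1 hL.start_mem
  obtain rfl : i = 1 := Finset.mem_singleton.1 hi
  have hr := (Finset.mem_product.1 hL.accept_mem).1
  obtain ⟨E, w, hrun, hE⟩ := exists_mRun_of_walk C hL.walk hL.trans_mem (by lia) 0
  have hrep : Represents σ E w := represents_of_mRun hrun (by lia) htag
  have hchain := hrep.holds_copies_iff.1 hcopies
  refine ⟨w, (exists_cRun_conAut_iff C w).1 ⟨q, hq, r, hr, hrun.cRun⟩, fun D => ?_⟩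
  rw [word_ne_word_iff, ← hrep.holds_lenFormula_iff]
  exact (hdiseq D).imp_right fun ⟨hmis, hsym⟩ =>
    hrep.exists_isMismatch_of_holds hchain hconsist hmis hsym

end

end MultiDiseq

/-! ### From words to models -/

namespace MultiDiseq

open TagAut (tagCount)

variable {A : Type uA} {X : Type uX} {Q : X → Type uQ} {I : Type uI} {n : ℕ}

/-- The list `E` can be sampled by a run that reads `u`, the letters being counted from `pos` on:
it takes one sample for every target of `T` in the range of this run, where a target `(x, j)` is
position `j` of the variable `x`. A copy is taken after the letter that it copies is read. -/
structure Samples (T : Fin n × Side → Option (X × ℕ)) (pos : X → ℕ) (u : X → List A)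
    (E : List (Sample A X n)) : Prop where
  target : ∀ e ∈ E, ∃ j, T e.key = some (e.var, j) ∧ pos e.var ≤ j ∧
    e.pos e.var = j + if e.letter = none then 1 else 0
  nodup : (E.map Sample.key).Nodup
  mem_keys : ∀ k x j, T k = some (x, j) → pos x ≤ j → j < pos x + (u x).length →
    k ∈ E.map Sample.key
  isChain : E.IsChain Sample.Precedes
  letter_ne_none : ∀ e ∈ E[0]?, e.letter ≠ none

/-- The copies taken for `ks` of the letter of `z` read just before `pos`. -/
def copies (A : Type uA) (z : X) (pos : X → ℕ) (ks : List (Fin n × Side)) : List (Sample A X n) :=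
  ks.map fun k => ⟨z, k.1, k.2, none, pos⟩

theorem map_key_copies (z : X) (pos : X → ℕ) (ks : List (Fin n × Side)) :
    (copies A z pos ks).map Sample.key = ks :=
  List.map_map.trans (List.map_id ks)

theorem MRun.exists_copies {S : Type*} {M : TagAut (Tag A X n) S} {pos : X → ℕ} {q r : S}
    {E : List (Sample A X n)} {u : X → List A} (hq : q ∈ M.states) (z : X)
    (ks : List (Fin n × Side)) {i : ℕ} (hi : 2 ≤ i)
    {L : List ((S × ℕ) × Finset (Tag A X n) × (S × ℕ))}
    (h : MRun M (i + ks.length) pos q L E u r) :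
    ∃ L', MRun M i pos q L' (copies A z pos ks ++ E) u r := by
  induction ks generalizing i with
  | nil => exact ⟨L, h⟩
  | cons k ks ih =>
    rw [List.length_cons, add_comm ks.length, ← add_assoc] at h
    obtain ⟨L', hL'⟩ := ih (Nat.le_succ_of_le hi) h
    exact ⟨_, .cop z k.1 k.2 hi hq hL'⟩

theorem isChain_cons_copies_append {E : List (Sample A X n)} (hE : E.IsChain Sample.Precedes)
    (hE₀ : ∀ e ∈ E[0]?, e.letter ≠ none) {pos : X → ℕ} (ks : List (Fin n × Side))
    (e : Sample A X n) (hpos : pos e.var = e.pos e.var + if e.letter = none then 0 else 1) :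
    (e :: (copies A e.var pos ks ++ E)).IsChain Sample.Precedes := by
  induction ks generalizing e with
  | nil =>
    cases E with
    | nil => exact List.isChain_singleton e
    | cons e' E => exact List.isChain_cons_cons.2 ⟨fun hl => absurd hl (hE₀ e' rfl), hE⟩
  | cons k ks ih => exact List.isChain_cons_cons.2 ⟨fun _ => ⟨rfl, hpos⟩, ih _ rfl⟩

namespace Samples

variable {T : Fin n × Side → Option (X × ℕ)} {pos : X → ℕ} {u : X → List A}
  {E : List (Sample A X n)} {z : X} {a : A}

theorem nil (T : Fin n × Side → Option (X × ℕ)) (pos : X → ℕ) :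
    Samples T pos (fun _ => ([] : List A)) [] where
  target := by simp
  nodup := by simp
  mem_keys _ _ _ _ hle hlt := absurd hlt hle.not_gt
  isChain := .nil
  letter_ne_none := by simp

open scoped Classical in
theorem mem_keys_or_eq (h : Samples T (pos + Pi.single z 1) u E) {k : Fin n × Side} {x : X} {j : ℕ}
    (hk : T k = some (x, j)) (hle : pos x ≤ j) (hlt : j < pos x + (consAt u z a x).length) :
    T k = some (z, pos z) ∨ k ∈ E.map Sample.key := by
  rw [length_consAt] at hlt
  rcases eq_or_ne x z with rfl | hx
  · rcases hle.eq_or_lt with rfl | hj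
    · exact .inl hk
    · rw [if_pos rfl] at hlt
      exact .inr (h.mem_keys k x j hk (by simpa using hj) (by simp; lia))
  · exact .inr (h.mem_keys k x j hk (by simpa [hx] using hle) (by simpa [hx] using hlt))

open scoped Classical in
theorem exists_target (h : Samples T (pos + Pi.single z 1) u E) {e : Sample A X n} (he : e ∈ E) :
    ∃ j, T e.key = some (e.var, j) ∧ pos e.var ≤ j ∧
      e.pos e.var = j + if e.letter = none then 1 else 0 := by
  obtain ⟨j, hj, hle, hpos⟩ := h.target e he
  exact ⟨j, hj, (Nat.le_add_right _ _).trans hle, hpos⟩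

open scoped Classical in
theorem read (h : Samples T (pos + Pi.single z 1) u E) (hz : ∀ k, T k ≠ some (z, pos z)) :
    Samples T pos (consAt u z a) E where
  target _ he := h.exists_target he
  nodup := h.nodup
  mem_keys k _ _ hk hle hlt := (h.mem_keys_or_eq hk hle hlt).resolve_left (hz k)
  isChain := h.isChain
  letter_ne_none := h.letter_ne_none

open scoped Classical in
theorem mis (h : Samples T (pos + Pi.single z 1) u E) {k₀ : Fin n × Side}
    {ks : List (Fin n × Side)} (hks : (k₀ :: ks).Nodup)
    (hz : ∀ k, k ∈ k₀ :: ks ↔ T k = some (z, pos z)) :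
    Samples T pos (consAt u z a)
      (⟨z, k₀.1, k₀.2, some a, pos⟩ :: (copies A z (pos + Pi.single z 1) ks ++ E)) := by
  have hkey : (⟨z, k₀.1, k₀.2, some a, pos⟩ :: (copies A z (pos + Pi.single z 1) ks ++ E)).map
      Sample.key = (k₀ :: ks) ++ E.map Sample.key := by
    rw [List.map_cons, List.map_append, map_key_copies]
    rfl
  refine ⟨fun e he => ?_, ?_, fun k x j hk hle hlt => ?_,
    isChain_cons_copies_append h.isChain h.letter_ne_none ks _ (by simp), by simp⟩
  · rw [List.mem_cons, List.mem_append, copies, List.mem_map] at he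
    rcases he with rfl | ⟨k, hk, rfl⟩ | he
    · exact ⟨pos z, (hz k₀).1 List.mem_cons_self, le_rfl, by simp⟩
    · exact ⟨pos z, (hz k).1 (List.mem_cons_of_mem k₀ hk), le_rfl, by simp⟩
    · exact h.exists_target he
  · rw [hkey, List.nodup_append']
    refine ⟨hks, h.nodup, fun k hk hkE => ?_⟩
    obtain ⟨e, he, rfl⟩ := List.mem_map.1 hkE
    obtain ⟨j, hj, hle, -⟩ := h.target e he
    rw [(hz _).1 hk, Option.some.injEq, Prod.mk.injEq] at hj
    simp [← hj.1, ← hj.2] at hle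
  · rw [hkey, List.mem_append, hz]
    exact h.mem_keys_or_eq hk hle hlt

end Samples

theorem CRun.exists_mRun {S : Type*} {M : TagAut (Tag A X n) S} (hM : ∀ s, s ∈ M.states)
    (T : Fin n × Side → Option (X × ℕ)) {q r : S} {u : X → List A} (h : CRun M q u r) {i : ℕ}
    (hi : 1 ≤ i) (pos : X → ℕ) : ∃ L E, MRun M i pos q L E u r ∧ Samples T pos u E := by
  classical
  induction h generalizing i pos with
  | nil q => exact ⟨[], [], .nil i pos q, .nil T pos⟩
  | eps ht _ ih =>
    obtain ⟨L, E, hL, hE⟩ := ih hi pos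
    exact ⟨_, E, .eps hi ht hL, hE⟩
  | @read _ q' _ _ a z ht _ ih =>
    have hks (k) : k ∈ (Finset.univ.filter fun k => T k = some (z, pos z)).toList ↔
      T k = some (z, pos z) := by simp
    have hnodup := Finset.nodup_toList (Finset.univ.filter fun k => T k = some (z, pos z))
    revert hks hnodup
    rcases (Finset.univ.filter fun k => T k = some (z, pos z)).toList with _ | ⟨k₀, ks⟩ <;>
      intro hks hnodup
    · obtain ⟨L, E, hL, hE⟩ := ih hi (pos + Pi.single z 1)
      exact ⟨_, E, .read a z hi ht hL, hE.read fun k hk => List.not_mem_nil ((hks k).2 hk)⟩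
    · obtain ⟨L, E, hL, hE⟩ := ih (i := i + 1 + ks.length) (by lia) (pos + Pi.single z 1)
      obtain ⟨L', hL'⟩ := hL.exists_copies (hM q') z ks (by lia)
      exact ⟨_, _, .mis a z k₀.1 k₀.2 hi ht hL', hE.mis hnodup hks⟩

/-- The targets `T` witness the disequalities with left sides `lhs` and right sides `rhs`: those
whose sides have the same length have the two positions of a mismatch as targets, the others may
have no target. -/
def IsWitness (w : X → List A) (lhs rhs : Fin n → List X) (T : Fin n × Side → Option (X × ℕ)) :
    Prop :=
  ∀ D, ((DiseqConstraint.word w (lhs D)).length ≠ (DiseqConstraint.word w (rhs D)).length ∧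
      ∀ s, T (D, s) = none) ∨
    ∃ i j p q, IsMismatch w (lhs D) (rhs D) i j p q ∧
      T (D, .left) = some ((lhs D).get i, p) ∧ T (D, .right) = some ((rhs D).get j, q)

theorem exists_isWitness {w : X → List A} {lhs rhs : Fin n → List X}
    (h : ∀ D, DiseqConstraint.word w (lhs D) ≠ DiseqConstraint.word w (rhs D)) :
    ∃ T, IsWitness w lhs rhs T := by
  have (D : Fin n) : ∃ t : Side → Option (X × ℕ),
      ((DiseqConstraint.word w (lhs D)).length ≠ (DiseqConstraint.word w (rhs D)).length ∧
        ∀ s, t s = none) ∨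
      ∃ i j p q, IsMismatch w (lhs D) (rhs D) i j p q ∧
        t .left = some ((lhs D).get i, p) ∧ t .right = some ((rhs D).get j, q) := by
    rcases word_ne_word_iff.1 (h D) with hlen | ⟨i, j, p, q, hmis⟩
    · exact ⟨fun _ => none, .inl ⟨hlen, fun _ => rfl⟩⟩
    · exact ⟨fun | .left => some ((lhs D).get i, p) | .right => some ((rhs D).get j, q),
        .inr ⟨i, j, p, q, hmis, rfl, rfl⟩⟩
  choose t ht using this
  exact ⟨fun k => t k.1 k.2, ht⟩

namespace IsWitness

variable {w : X → List A} {lhs rhs : Fin n → List X} {T : Fin n × Side → Option (X × ℕ)}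

theorem lt_length (h : IsWitness w lhs rhs T) {k : Fin n × Side} {x : X} {j : ℕ}
    (hk : T k = some (x, j)) : j < (w x).length := by
  obtain ⟨D, s⟩ := k
  rcases h D with ⟨-, hnone⟩ | ⟨i, i', p, q, ⟨⟨a, b, ha, hb, -⟩, -⟩, hl, hr⟩
  · rw [hnone] at hk
    cases hk
  · cases s with
    | left =>
      cases hl.symm.trans hk
      exact (List.getElem?_eq_some_iff.1 ha).1
    | right =>
      cases hr.symm.trans hk
      exact (List.getElem?_eq_some_iff.1 hb).1

theorem ne_none_iff (h : IsWitness w lhs rhs T) (D : Fin n) (s : Side) :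
    T (D, s) ≠ none ↔ T (D, .left) ≠ none := by
  rcases h D with ⟨-, hnone⟩ | ⟨i, j, p, q, -, hl, hr⟩
  · rw [hnone, hnone]
  · cases s <;> simp [hl, hr]

end IsWitness

namespace Samples

variable {w : X → List A} {lhs rhs : Fin n → List X} {T : Fin n × Side → Option (X × ℕ)}
  {E : List (Sample A X n)}

theorem mem_map_key_iff (h : Samples T 0 w E) (hT : IsWitness w lhs rhs T) (k : Fin n × Side) :
    k ∈ E.map Sample.key ↔ T k ≠ none := by
  constructor
  · intro hk
    obtain ⟨e, he, rfl⟩ := List.mem_map.1 hk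
    obtain ⟨j, hj, -⟩ := h.target e he
    exact hj ▸ Option.some_ne_none _
  · intro hk
    obtain ⟨⟨x, j⟩, hxj⟩ := Option.ne_none_iff_exists'.1 hk
    exact h.mem_keys k x j hxj (Nat.zero_le j) (by simpa using hT.lt_length hxj)

/-- A disequality is sampled either for both sides or for none. -/
theorem length_eq_mul_two (h : Samples T 0 w E) (hT : IsWitness w lhs rhs T) :
    ∃ k ≤ n, E.length = k * 2 := by
  classical
  have hkeys : (E.map Sample.key).toFinset =
      (Finset.univ.filter fun D => T (D, .left) ≠ none) ×ˢ (Finset.univ : Finset Side) := by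
    ext ⟨D, s⟩
    simp only [List.mem_toFinset, h.mem_map_key_iff hT, Finset.mem_product, Finset.mem_filter,
      Finset.mem_univ, true_and, and_true]
    exact hT.ne_none_iff D s
  refine ⟨_, card_finset_fin_le (Finset.univ.filter fun D => T (D, .left) ≠ none), ?_⟩
  rw [← List.length_map (f := Sample.key), ← List.toFinset_card_of_nodup h.nodup, hkeys,
    Finset.card_product]
  rfl

theorem target_eq_of_precedes (h : Samples T 0 w E) {e e' : Sample A X n} (he : e ∈ E)
    (he' : e' ∈ E) (hprec : e.Precedes e') (hl : e'.letter = none) : T e'.key = T e.key := by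
  obtain ⟨j, hj, -, hpos⟩ := h.target e he
  obtain ⟨j', hj', -, hpos'⟩ := h.target e' he'
  obtain ⟨hvar, hprec⟩ := hprec hl
  rw [hj, hj', ← hvar]
  rw [← hvar, hprec, hpos] at hpos'
  congr 2
  split_ifs at hpos' <;> lia

end Samples

/-- The code of the letter of `w` at a target. -/
noncomputable def targetCode [Fintype A] (w : X → List A) : Option (X × ℕ) → ℤ
  | none => 0
  | some (x, j) => match (w x)[j]? with
    | none => 0
    | some a => (Fintype.equivFin A a : ℕ)

theorem targetCode_some [Fintype A] {w : X → List A} {x : X} {j : ℕ} {a : A}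
    (h : (w x)[j]? = some a) : targetCode w (some (x, j)) = (Fintype.equivFin A a : ℕ) := by
  simp only [targetCode, h]

/-- The values of the variables of the formula on a run that samples `E` for the targets `T`,
`σ₀` being the values of the variables of its Parikh formula. -/
noncomputable def samplingModel [Fintype A] {S : Type*} (σ₀ : PVar (Tag A X n) S → ℤ)
    (w : X → List A) (T : Fin n × Side → Option (X × ℕ)) (E : List (Sample A X n)) :
    MVar A X S n → ℤ
  | .parikh v => σ₀ v
  | .misSym D s => targetCode w (T (D, s))
  | .shared i => targetCode w (E[i - 1]?.bind fun e => T e.key)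
  | .misPos D s => (T (D, s)).elim 0 fun d => d.2

namespace Samples

variable [Fintype A] {S : Type*} {σ₀ : PVar (Tag A X n) S → ℤ} {w : X → List A}
  {T : Fin n × Side → Option (X × ℕ)} {E : List (Sample A X n)}

theorem holds_consist [Fintype X] (h : Samples T 0 w E)
    (hrep : Represents (samplingModel σ₀ w T E) E w) :
    (consistFormula A X S n).Holds (samplingModel σ₀ w T E) := by
  have shared_eq {k : ℕ} {e : Sample A X n} (he : e ∈ E[k]?) :
      samplingModel σ₀ w T E (.shared (k + 1)) = targetCode w (T e.key) := by
    rw [Option.mem_def] at he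
    simp only [samplingModel, Nat.add_sub_cancel, he, Option.bind_some]
  refine hrep.holds_consist_iff.2 fun k e he => ⟨shared_eq he, fun a ha => ?_, fun hl => ?_⟩
  · have hmem := List.mem_of_getElem? he
    obtain ⟨j, hj, -, hpos⟩ := h.target e hmem
    rw [if_neg (by simp [ha]), add_zero] at hpos
    change targetCode w (T e.key) = _
    rw [hj]
    exact targetCode_some (hpos ▸ hrep.getElem?_var_eq_letter e hmem a ha)
  · cases k with
    | zero => exact absurd hl (h.letter_ne_none e he)
    | succ k =>
      obtain ⟨hk, rfl⟩ := List.getElem?_eq_some_iff.1 he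
      rw [shared_eq (List.getElem?_eq_getElem (Nat.lt_of_succ_lt hk))]
      exact congrArg (targetCode w) (h.target_eq_of_precedes (List.getElem_mem _)
        (List.getElem_mem _) (List.isChain_iff_getElem.1 h.isChain k hk) hl)

theorem holds_pos (h : Samples T 0 w E) (hrep : Represents (samplingModel σ₀ w T E) E w)
    {D : Fin n} {s : Side} {x : X} {p : ℕ} (hT : T (D, s) = some (x, p)) :
    (posFormula (A := A) (S := S) D s x).Holds (samplingModel σ₀ w T E) := by
  rw [hrep.holds_pos_iff]
  rintro e he rfl rfl rfl
  obtain ⟨j, hj, -, hpos⟩ := h.target e he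
  cases hT.symm.trans hj
  simp only [samplingModel, hT, Option.elim_some, hpos]
  split_ifs <;> simp

theorem holds_present (h : Samples T 0 w E) (hrep : Represents (samplingModel σ₀ w T E) E w)
    {lhs rhs : Fin n → List X} (hw : IsWitness w lhs rhs T) {D : Fin n} {s : Side} {x : X} {p : ℕ}
    (hT : T (D, s) = some (x, p)) :
    (presentFormula (A := A) (S := S) D s x).Holds (samplingModel σ₀ w T E) := by
  rw [hrep.holds_present_iff]
  obtain ⟨e, he, hkey⟩ := List.mem_map.1 ((h.mem_map_key_iff hw (D, s)).2 (by simp [hT]))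
  obtain ⟨j, hj, -⟩ := h.target e he
  rw [hkey] at hj
  cases hT.symm.trans hj
  exact ⟨e, he, rfl, congrArg Prod.fst hkey, congrArg Prod.snd hkey⟩

theorem holds_diseq (h : Samples T 0 w E) (hrep : Represents (samplingModel σ₀ w T E) E w)
    {lhs rhs : Fin n → List X} (hw : IsWitness w lhs rhs T) (D : Fin n) :
    (lenFormula (lhs D) (rhs D)).Holds (samplingModel σ₀ w T E) ∨
      (misFormula D (lhs D) (rhs D)).Holds (samplingModel σ₀ w T E) ∧
      (symFormula D).Holds (samplingModel σ₀ w T E) := by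
  rcases hw D with ⟨hlen, -⟩ | ⟨i, j, p, q, ⟨⟨a, b, ha, hb, hab⟩, hg⟩, hl, hr⟩
  · exact .inl ((hrep.holds_lenFormula_iff _ _).2 hlen)
  · refine .inr ⟨?_, ?_⟩
    · simp only [misFormula, LIA.holds_disj, Finset.mem_univ, true_and, LIA.Holds, alignFormula,
        LTerm.eval, hrep.eval_lenTerm, posVar]
      refine ⟨(i, j), h.holds_pos hrep hl, h.holds_pos hrep hr, ?_,
        h.holds_present hrep hw hl, h.holds_present hrep hw hr⟩
      simp only [samplingModel, hl, hr, Option.elim_some]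
      exact_mod_cast hg
    · rw [symFormula, LIA.holds_ne]
      simp only [symVar, LTerm.eval, samplingModel, hl, hr, targetCode_some ha, targetCode_some hb]
      rwa [Nat.cast_inj.ne, Fin.val_injective.ne_iff, (Fintype.equivFin A).injective.ne_iff]

end Samples

theorem holds_intFormula_iff (C : DiseqConstraint A X Q I n) (v : I → ℤ) :
    C.intFormula.Holds v ↔ ∀ c ∈ C.ints, c.1.eval v ≤ c.2.eval v := by
  rw [DiseqConstraint.intFormula, LIA.holds_listConj, List.forall_mem_map]
  rfl

section

variable [Fintype A] [Fintype X] [LinearOrder X] [∀ x, Fintype (Q x)] [Nonempty X]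
  (C : DiseqConstraint A X Q I n)

theorem exists_holds_of_words {w : X → List A} (hw : ∀ x, w x ∈ (C.nfa x).accepts)
    (hne : ∀ D, DiseqConstraint.word w (C.lhs D) ≠ DiseqConstraint.word w (C.rhs D)) :
    ∃ σ, (formula C).Holds σ := by
  obtain ⟨q, hq, r, hr, hcrun⟩ := (exists_cRun_conAut_iff C w).2 hw
  obtain ⟨T, hT⟩ := exists_isWitness hne
  obtain ⟨L, E, hL, hE⟩ := hcrun.exists_mRun (mem_conAut_states C) T le_rfl 0
  obtain ⟨k, hkn, hk⟩ := hE.length_eq_mul_two hT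
  obtain ⟨hwalk, hmem⟩ := hL.isWalk C (by lia)
  have hrun : (multiAut C).IsRun (q, 1) L (r, 1 + E.length) := by
    refine ⟨by simp [multiAut, hq], ?_, hwalk, hmem⟩
    simp only [multiAut, Finset.mem_product, Finset.mem_filter, Finset.mem_Icc]
    exact ⟨hr, by lia, k, by lia⟩
  obtain ⟨σ₀, hσ₀, htag⟩ := TagAut.exists_holds_of_run hrun (allTags A X n)
  have hrep : Represents (samplingModel σ₀ w T E) E w :=
    represents_of_mRun hL (by lia) fun τ _ => htag τ
  exact ⟨samplingModel σ₀ w T E, (holds_formula_iff C _).2 ⟨hσ₀, hrep.holds_fair hE.nodup,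
    hE.holds_consist hrep, hrep.holds_copies_iff.2 hE.isChain, hE.holds_diseq hrep hT⟩⟩

theorem satisfiable_iff : C.Satisfiable ↔ (fullFormula C).Satisfiable := by
  simp only [LIA.Satisfiable, fullFormula, LIA.Holds, LIA.holds_rename, holds_intFormula_iff]
  constructor
  · rintro ⟨w, v, hw, hv, hne⟩
    obtain ⟨σ, hσ⟩ := exists_holds_of_words C hw hne
    exact ⟨Sum.elim v σ, hv, hσ⟩
  · rintro ⟨σ, hints, hσ⟩
    obtain ⟨w, hw, hne⟩ := exists_words_of_holds C hσ
    exact ⟨w, _, hw, hints, hne⟩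

end

end MultiDiseq

/-! ### The size of the formula -/

theorem LTerm.size_rename {V W : Type*} (f : V → W) (t : LTerm V) :
    (t.rename f).size = t.size := by
  induction t with
  | var => rfl
  | const => rfl
  | add _ _ iht ihu => simp only [rename, size, iht, ihu]
  | sub _ _ iht ihu => simp only [rename, size, iht, ihu]

theorem LIA.size_rename {V W : Type*} (f : V → W) (φ : LIA V) :
    (φ.rename f).size = φ.size := by
  induction φ with
  | tt => rfl
  | ff => rfl
  | le => simp only [rename, size, LTerm.size_rename]
  | eq => simp only [rename, size, LTerm.size_rename]
  | not _ ih => simp only [rename, size, ih]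
  | and _ _ ihφ ihψ => simp only [rename, size, ihφ, ihψ]
  | or _ _ ihφ ihψ => simp only [rename, size, ihφ, ihψ]
  | imp _ _ ihφ ihψ => simp only [rename, size, ihφ, ihψ]

/-- The number `a` is at most `(b + 3) ^ k`. Sizes of formulas and cardinalities are bounded in
this form because a base of at least `3` absorbs additive constants: building a formula from
subformulas only increases the exponent, by an amount that does not depend on the base. -/
def PowBound (b k a : ℕ) : Prop :=
  a ≤ (b + 3) ^ k

namespace PowBound

variable {b i j k a c : ℕ} {V ι : Type*}

theorem mono (h : PowBound b i a) (hik : i ≤ k) : PowBound b k a :=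
  h.trans (Nat.pow_le_pow_right (Nat.succ_pos _) hik)

theorem of_le (h : PowBound b k a) (hc : c ≤ a) : PowBound b k c :=
  hc.trans h

theorem one_of_le (h : a ≤ b + 3) : PowBound b 1 a :=
  h.trans_eq (pow_one _).symm

theorem mul (ha : PowBound b i a) (hc : PowBound b j c) : PowBound b (i + j) (a * c) :=
  (Nat.mul_le_mul ha hc).trans_eq (pow_add _ _ _).symm

theorem one_add_add (ha : PowBound b i a) (hc : PowBound b j c) :
    PowBound b (max i j + 1) (1 + a + c) := by
  have ha' := ha.mono (le_max_left i j)
  have hc' := hc.mono (le_max_right i j)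
  have hpos : 1 ≤ (b + 3) ^ max i j := Nat.one_le_pow' _ _
  unfold PowBound at *
  calc 1 + a + c ≤ 3 * (b + 3) ^ max i j := by lia
    _ ≤ (b + 3) * (b + 3) ^ max i j := Nat.mul_le_mul_right _ (Nat.le_add_left 3 b)
    _ = (b + 3) ^ (max i j + 1) := (pow_succ' _ _).symm

theorem one_add (ha : PowBound b i a) : PowBound b (i + 1) (1 + a) := by
  simpa only [max_self] using (ha.one_add_add ha).of_le (Nat.le_add_right _ a)

theorem one_add_mul (hc : PowBound b i c) : PowBound b (i + j + 1) (1 + c * (1 + (b + 3) ^ j)) := by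
  have hpow : PowBound b j ((b + 3) ^ j) := le_rfl
  have hc' : PowBound b (i + j) c := hc.mono (Nat.le_add_right i j)
  simpa only [max_self, mul_add, mul_one, add_assoc] using hc'.one_add_add (hc.mul hpow)

theorem var {v : V} : PowBound b 0 (LTerm.var v).size :=
  le_rfl

theorem const_zero : PowBound b 0 (LTerm.const 0 : LTerm V).size := by
  simp [PowBound, LTerm.size]

theorem const {z : ℤ} (hz : PowBound b i z.natAbs) :
    PowBound b (i + 1) (LTerm.const z : LTerm V).size :=
  one_add <| hz.of_le <| Nat.size_le.2 Nat.lt_two_pow_self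

theorem const_one : PowBound b 1 (LTerm.const 1 : LTerm V).size :=
  const (i := 0) le_rfl

theorem const_neg_one : PowBound b 1 (LTerm.const (-1) : LTerm V).size :=
  const (i := 0) le_rfl

theorem add {t u : LTerm V} (ht : PowBound b i t.size) (hu : PowBound b j u.size) :
    PowBound b (max i j + 1) (t.add u).size :=
  ht.one_add_add hu

theorem sub {t u : LTerm V} (ht : PowBound b i t.size) (hu : PowBound b j u.size) :
    PowBound b (max i j + 1) (t.sub u).size :=
  ht.one_add_add hu

theorem le {t u : LTerm V} (ht : PowBound b i t.size) (hu : PowBound b j u.size) :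
    PowBound b (max i j + 1) (LIA.le t u).size :=
  ht.one_add_add hu

theorem eq {t u : LTerm V} (ht : PowBound b i t.size) (hu : PowBound b j u.size) :
    PowBound b (max i j + 1) (LIA.eq t u).size :=
  ht.one_add_add hu

theorem lt {t u : LTerm V} (ht : PowBound b i t.size) (hu : PowBound b j u.size) :
    PowBound b (max j i + 1 + 1) (LIA.lt t u).size :=
  (hu.le ht).one_add

theorem ne {t u : LTerm V} (ht : PowBound b i t.size) (hu : PowBound b j u.size) :
    PowBound b (max i j + 1 + 1) (LIA.ne t u).size :=
  (ht.eq hu).one_add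

theorem and {φ ψ : LIA V} (hφ : PowBound b i φ.size) (hψ : PowBound b j ψ.size) :
    PowBound b (max i j + 1) (φ.and ψ).size :=
  hφ.one_add_add hψ

theorem or {φ ψ : LIA V} (hφ : PowBound b i φ.size) (hψ : PowBound b j ψ.size) :
    PowBound b (max i j + 1) (φ.or ψ).size :=
  hφ.one_add_add hψ

theorem imp {φ ψ : LIA V} (hφ : PowBound b i φ.size) (hψ : PowBound b j ψ.size) :
    PowBound b (max i j + 1) (φ.imp ψ).size :=
  hφ.one_add_add hψ

theorem iff {φ ψ : LIA V} (hφ : PowBound b i φ.size) (hψ : PowBound b j ψ.size) :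
    PowBound b (max (max i j + 1) (max j i + 1) + 1) (φ.iff ψ).size :=
  (hφ.imp hψ).and (hψ.imp hφ)

theorem listSum {l : List (LTerm V)} (hl : PowBound b i l.length)
    (h : ∀ t ∈ l, PowBound b j t.size) : PowBound b (i + j + 1) (LTerm.listSum l).size := by
  refine hl.one_add_mul.of_le ?_
  clear hl
  induction l with
  | nil => simp [LTerm.listSum, LTerm.size]
  | cons t l ih =>
    have ht : t.size ≤ _ := h t List.mem_cons_self
    have hl := ih fun u hu => h u (List.mem_cons_of_mem t hu)
    rw [List.length_cons, Nat.add_mul]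
    change 1 + t.size + (LTerm.listSum l).size ≤ _
    lia

theorem listConj {l : List (LIA V)} (hl : PowBound b i l.length)
    (h : ∀ φ ∈ l, PowBound b j φ.size) : PowBound b (i + j + 1) (LIA.listConj l).size := by
  refine hl.one_add_mul.of_le ?_
  clear hl
  induction l with
  | nil => simp [LIA.listConj, LIA.size]
  | cons φ l ih =>
    have hφ : φ.size ≤ _ := h φ List.mem_cons_self
    have hl := ih fun ψ hψ => h ψ (List.mem_cons_of_mem φ hψ)
    rw [List.length_cons, Nat.add_mul]
    change 1 + φ.size + (LIA.listConj l).size ≤ _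
    lia

theorem listDisj {l : List (LIA V)} (hl : PowBound b i l.length)
    (h : ∀ φ ∈ l, PowBound b j φ.size) : PowBound b (i + j + 1) (LIA.listDisj l).size := by
  refine hl.one_add_mul.of_le ?_
  clear hl
  induction l with
  | nil => simp [LIA.listDisj, LIA.size]
  | cons φ l ih =>
    have hφ : φ.size ≤ _ := h φ List.mem_cons_self
    have hl := ih fun ψ hψ => h ψ (List.mem_cons_of_mem φ hψ)
    rw [List.length_cons, Nat.add_mul]
    change 1 + φ.size + (LIA.listDisj l).size ≤ _
    lia

section

variable {s : Finset ι} (hs : PowBound b i s.card)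
include hs

theorem sum {f : ι → LTerm V} (h : ∀ x ∈ s, PowBound b j (f x).size) :
    PowBound b (i + j + 1) (LTerm.sum s f).size :=
  listSum (by simpa using hs) (by simpa using h)

theorem conj {f : ι → LIA V} (h : ∀ x ∈ s, PowBound b j (f x).size) :
    PowBound b (i + j + 1) (LIA.conj s f).size :=
  listConj (by simpa using hs) (by simpa using h)

theorem disj {f : ι → LIA V} (h : ∀ x ∈ s, PowBound b j (f x).size) :
    PowBound b (i + j + 1) (LIA.disj s f).size :=
  listDisj (by simpa using hs) (by simpa using h)

theorem card_subset {t : Finset ι} (hts : t ⊆ s) : PowBound b i t.card :=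
  hs.of_le (Finset.card_le_card hts)

theorem card_image {κ : Type*} [DecidableEq κ] (f : ι → κ) : PowBound b i (s.image f).card :=
  hs.of_le Finset.card_image_le

theorem card_union [DecidableEq ι] {t : Finset ι} (ht : PowBound b j t.card) :
    PowBound b (max i j + 1) (s ∪ t).card :=
  (hs.one_add_add ht).of_le <| (Finset.card_union_le s t).trans <|
    Nat.add_le_add_right (Nat.le_add_left _ 1) _

theorem card_product {κ : Type*} {t : Finset κ} (ht : PowBound b j t.card) :
    PowBound b (i + j) (s ×ˢ t).card :=
  (hs.mul ht).of_le (Finset.card_product s t).le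

end

theorem card_prod {α β : Type*} [Fintype α] [Fintype β] (hα : PowBound b i (Fintype.card α))
    (hβ : PowBound b j (Fintype.card β)) : PowBound b (i + j) (Fintype.card (α × β)) :=
  (hα.mul hβ).of_le (Fintype.card_prod α β).le

theorem card_Icc {l : ℕ} (ha : PowBound b i a) (hl : 1 ≤ l) : PowBound b i (Finset.Icc l a).card :=
  ha.of_le (by rw [Nat.card_Icc]; lia)

theorem card_Ico {l : ℕ} (ha : PowBound b i a) : PowBound b i (Finset.Ico l a).card :=
  ha.of_le (by rw [Nat.card_Ico]; lia)

end PowBound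

namespace TagAut

variable {T S : Type*} {M : TagAut T S} {b i j k : ℕ}

theorem powBound_initFormula (hM : M.start ⊆ M.states) (hs : PowBound b i M.states.card) :
    PowBound b (i + 5) M.initFormula.size := by
  classical
  have hstart := hs.card_subset hM
  have hrest := hs.card_subset (M.states.sdiff_subset (t := M.start))
  refine .mono (.and (.conj hstart fun q _ => .and (.le .const_zero .var) (.le .var .const_one))
    (.and (.conj hrest fun q _ => .eq .var .const_zero)
      (.eq (.sum hstart fun q _ => .var) .const_one))) ?_
  lia

theorem powBound_finalFormula (hM : M.accept ⊆ M.states) (hs : PowBound b i M.states.card) :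
    PowBound b (i + 5) M.finalFormula.size := by
  classical
  have haccept := hs.card_subset hM
  have hrest := hs.card_subset (M.states.sdiff_subset (t := M.accept))
  refine .mono (.and (.conj haccept fun q _ => .and (.le .const_zero .var) (.le .var .const_one))
    (.conj hrest fun q _ => .eq .var .const_zero)) ?_
  lia

open scoped Classical in
theorem powBound_kirchhoffFormula (ht : PowBound b j M.trans.card) (q : S) :
    PowBound b (j + 3) (M.kirchhoffFormula q).size := by
  have hin : PowBound b j (M.incoming q).card := ht.card_subset (Finset.filter_subset _ _)
  have hout : PowBound b j (M.outgoing q).card := ht.card_subset (Finset.filter_subset _ _)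
  refine .mono (.eq (.add .var (.sum hin fun t _ => .var)) (.add .var (.sum hout fun t _ => .var)))
    ?_
  lia

open scoped Classical in
theorem powBound_spanFormula (ht : PowBound b j M.trans.card) (q : S) :
    PowBound b (j + 9) (M.spanFormula q).size := by
  have hin : PowBound b j (M.incoming q).card := ht.card_subset (Finset.filter_subset _ _)
  refine .mono (.and (.iff (.eq .var .const_zero) (.eq .var .const_one))
    (.and
      (.imp (.le .var .const_neg_one)
        (.and (.eq .var .const_zero) (.conj hin fun t _ => .eq .var .const_zero)))
      (.imp (.lt .const_zero .var)
        (.disj hin fun t _ => .and (.lt .const_zero .var)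
          (.and (.le .const_zero .var) (.eq .var (.add .var .const_one))))))) ?_
  lia

theorem powBound_parikhTagFormula (hM : M.WellFormed) (hs : PowBound b i M.states.card)
    (ht : PowBound b j M.trans.card) {tags : Finset T} (htags : PowBound b k tags.card) :
    PowBound b (i + j + k + 15) (M.parikhTagFormula tags).size := by
  classical
  have htag : ∀ t, PowBound b j (M.trans.filter fun d => t ∈ d.2.1).card := fun t =>
    ht.card_subset (Finset.filter_subset _ _)
  refine .mono (.and
    (.and (.conj ht fun t _ => .le .const_zero .var)
      (.and (powBound_initFormula hM.start_subset hs)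
        (.and (powBound_finalFormula hM.accept_subset hs)
          (.conj hs fun q _ => .and (powBound_kirchhoffFormula ht q)
            (powBound_spanFormula ht q)))))
    (.conj htags fun t _ => .eq .var (.sum (htag t) fun d _ => .var))) ?_
  lia

end TagAut

namespace MultiDiseq

variable {A : Type uA} {X : Type uX} {Q : X → Type uQ} {I : Type uI} {n : ℕ} {S : Type*} {b : ℕ}

theorem powBound_card_side : PowBound b 1 (Fintype.card Side) :=
  .one_of_le (Nat.le_add_left 2 (b + 1))

theorem powBound_card_diseqs (hn : PowBound b 1 (2 * n + 1)) :
    PowBound b 1 (Fintype.card (Fin n)) :=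
  hn.of_le (by rw [Fintype.card_fin]; lia)

theorem powBound_card_sides (hn : PowBound b 1 (2 * n + 1)) :
    PowBound b 1 (Fintype.card (Fin n × Side)) :=
  hn.of_le <| by
    rw [Fintype.card_prod, Fintype.card_fin, show Fintype.card Side = 2 from rfl]
    lia

theorem powBound_card_Icc (hn : PowBound b 1 (2 * n + 1)) {i : ℕ} (hi : 1 ≤ i) :
    PowBound b 1 (Finset.Icc i (2 * n)).card :=
  (hn.of_le (Nat.le_succ _)).card_Icc hi

theorem powBound_copTotal (hn : PowBound b 1 (2 * n + 1)) (i : ℕ) (x : X) :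
    PowBound b 2 (copTotal (A := A) (S := S) (n := n) i x).size :=
  .sum (powBound_card_sides hn) fun _ _ => .var

theorem powBound_lenTerm {l : List X} (hl : PowBound b 1 l.length) :
    PowBound b 2 (lenTerm (A := A) (S := S) (n := n) l).size :=
  .listSum (by simpa using hl) <| List.forall_mem_map.2 fun _ _ => .var

theorem powBound_posSum (hn : PowBound b 1 (2 * n + 1)) {k : ℕ} (hk : k ≤ 2 * n) (x : X) :
    PowBound b 2 (posSum (A := A) (S := S) (n := n) k x).size :=
  .sum ((hn.of_le (Nat.le_succ_of_le hk)).card_Icc le_rfl) fun _ _ => .var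

section

variable [Fintype A] (hA : PowBound b 1 (Fintype.card A))
include hA

theorem powBound_code (a : A) : PowBound b 2 (code (X := X) (S := S) (n := n) a).size :=
  .const <| hA.of_le (Fintype.equivFin A a).isLt.le

theorem powBound_misCount (i : ℕ) (x : X) (D : Fin n) (s : Side) :
    PowBound b 2 (misCount (A := A) (S := S) i x D s).size :=
  .sum hA fun _ _ => .var

variable (hn : PowBound b 1 (2 * n + 1))
include hn

theorem powBound_misTotal (i : ℕ) (x : X) :
    PowBound b 4 (misTotal (A := A) (S := S) (n := n) i x).size :=
  .sum (powBound_card_sides hn) fun d _ => powBound_misCount hA i x d.1 d.2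

theorem powBound_posFormula (D : Fin n) (s : Side) (x : X) :
    PowBound b 8 (posFormula (A := A) (S := S) D s x).size := by
  refine .mono (.and
    (.conj (powBound_card_Icc hn le_rfl) fun k hk =>
      .imp (.lt .const_zero (powBound_misCount hA k x D s)) (.eq .var (powBound_posSum hn ?_ x)))
    (.conj (powBound_card_Icc hn one_le_two) fun k hk => .imp (.lt .const_zero .var)
      (.eq .var (.sub (powBound_posSum hn ?_ x) .const_one)))) (by decide)
  all_goals exact (Finset.mem_Icc.1 hk).2

theorem powBound_presentFormula (D : Fin n) (s : Side) (x : X) :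
    PowBound b 9 (presentFormula (A := A) (S := S) D s x).size :=
  .mono (.lt .const_zero (.add (powBound_misCount hA 1 x D s)
    (.sum (powBound_card_Icc hn one_le_two) fun k _ =>
      .add (powBound_misCount hA k x D s) .var))) (by decide)

theorem powBound_misFormula (D : Fin n) {l r : List X} (hl : PowBound b 1 l.length)
    (hr : PowBound b 1 r.length) :
    PowBound b 16 (misFormula (A := A) (S := S) D l r).size := by
  have hlen {l : List X} (hl : PowBound b 1 l.length) (i : ℕ) :
      PowBound b 2 (lenTerm (A := A) (S := S) (n := n) (l.take i)).size :=
    powBound_lenTerm (hl.of_le (l.length_take_le' i))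
  have hcard : PowBound b 2 (Fintype.card (Fin l.length × Fin r.length)) :=
    .card_prod (i := 1) (j := 1) (by rwa [Fintype.card_fin]) (by rwa [Fintype.card_fin])
  exact .mono (.disj hcard fun e _ =>
    .and (powBound_posFormula hA hn D .left _) (.and (powBound_posFormula hA hn D .right _)
      (.and (.eq (.add (hlen hl _) .var) (.add (hlen hr _) .var))
        (.and (powBound_presentFormula hA hn D .left _)
          (powBound_presentFormula hA hn D .right _))))) (by decide)

variable [Fintype X] (hX : PowBound b 1 (Fintype.card X))
include hX

theorem powBound_fairFormula : PowBound b 9 (fairFormula A X S n).size :=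
  .mono (.conj (powBound_card_sides hn) fun e _ =>
    .le (.sum (.card_product (powBound_card_Icc hn le_rfl) hX) fun d _ =>
      .add (powBound_misCount hA d.1 d.2 e.1 e.2) .var) .const_one) (by decide)

theorem powBound_consistFormula : PowBound b 11 (consistFormula A X S n).size := by
  have hcard : PowBound b 3 (Fintype.card (Fin n × Side × A)) :=
    .card_prod (powBound_card_diseqs hn) (.card_prod powBound_card_side hA)
  refine .mono (.conj (j := 6) (.card_product hcard (powBound_card_Icc hn le_rfl)) ?_) (by decide)
  rintro ⟨⟨D, s, a⟩, i⟩ -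
  exact .mono (.and
    (.imp (.eq (.sum hX fun x _ => .var) .const_one)
      (.and (.eq .var .var) (.eq .var (powBound_code hA a))))
    (.imp (.eq (.sum hX fun x _ => .var) .const_one)
      (.and (.eq .var .var) (.eq .var .var)))) (by decide)

theorem powBound_copiesFormula : PowBound b 11 (copiesFormula A X S n).size :=
  .mono (.and
    (.conj (.card_product (.card_Ico (hn.of_le (Nat.le_succ _))) hX) fun e _ =>
      .imp (.eq (.add (powBound_misTotal hA hn _ _) (powBound_copTotal hn _ _)) .const_zero)
        (.eq (powBound_copTotal hn _ _) .const_zero))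
    (.conj (.card_product (powBound_card_Icc hn one_le_two) hX) fun e _ =>
      .imp (.eq (powBound_copTotal hn _ _) .const_one)
        (.eq (.sub .var (powBound_misTotal hA hn _ _)) .const_zero))) (by decide)

theorem powBound_card_allTags : PowBound b 8 (allTags A X n).card := by
  classical
  have hlevels := powBound_card_Icc hn le_rfl
  have hD := powBound_card_diseqs hn
  have hs : PowBound b 1 (Fintype.card Side) := powBound_card_side
  exact .mono (.card_union
    (.card_union
      (.card_union (.card_union (.card_image hA _) (.card_image hX _))
        (.card_image (.card_product hlevels (.card_prod hX (.card_prod hD (.card_prod hs hA)))) _))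
      (.card_image (.card_product hlevels (.card_prod hX (.card_prod hD hs))) _))
    (.card_image (.card_product (.card_Icc hn le_rfl) hX) _)) (by decide)

end

section

variable [Fintype X] [∀ x, Fintype (Q x)] (hQ : PowBound b 1 (Fintype.card (Σ x, Q x)))
include hQ

theorem powBound_card_epsMoves (M : TagAut (Tag A X n) (Σ x, Q x)) :
    PowBound b 2 (epsMoves M).card :=
  .card_subset (s := Finset.univ) (.card_prod hQ hQ) (Finset.subset_univ _)

variable [Fintype A]

theorem powBound_card_readMoves (hA : PowBound b 1 (Fintype.card A))
    (hX : PowBound b 1 (Fintype.card X)) (M : TagAut (Tag A X n) (Σ x, Q x)) :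
    PowBound b 4 (readMoves M).card :=
  .card_subset (s := Finset.univ) (.card_prod hQ (.card_prod hA (.card_prod hX hQ)))
    (Finset.subset_univ _)

variable [LinearOrder X] (C : DiseqConstraint A X Q I n) (hn : PowBound b 1 (2 * n + 1))
include hn

theorem powBound_card_multiAut_states : PowBound b 2 (multiAut C).states.card :=
  .card_product (.of_le hQ (Finset.card_le_univ _)) (.card_Icc hn le_rfl)

variable (hA : PowBound b 1 (Fintype.card A)) (hX : PowBound b 1 (Fintype.card X))
include hA hX

theorem powBound_card_multiAut_trans : PowBound b 9 (multiAut C).trans.card := by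
  classical
  have hread := powBound_card_readMoves hQ hA hX (conAut C)
  have heps := powBound_card_epsMoves hQ (conAut C)
  have hstates : PowBound b 1 (conAut C).states.card := .of_le hQ (Finset.card_le_univ _)
  have hsides := powBound_card_sides hn
  have hsteps {i : ℕ} (hi : 1 ≤ i) := powBound_card_Icc hn hi
  have hlevels := hn.card_Icc le_rfl
  exact .mono (.card_union
    (.card_union
      (.card_union (.card_image (.card_product hread hlevels) _)
        (.card_image (.card_product heps hlevels) _))
      (.card_image (.card_product hread (.card_product (hsteps le_rfl) hsides)) _))
    (.card_image (.card_product hstates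
      (.card_product (hsteps one_le_two) (.card_prod hX hsides))) _)) (by decide)

theorem powBound_formula (hm : PowBound b 1 C.maxSide) : PowBound b 36 (formula C).size := by
  have hside (D : Fin n) : PowBound b 1 (max (C.lhs D).length (C.rhs D).length) :=
    hm.of_le (Finset.le_sup (f := fun D => max (C.lhs D).length (C.rhs D).length)
      (Finset.mem_univ D))
  have hlhs (D : Fin n) := (hside D).of_le (le_max_left _ _)
  have hrhs (D : Fin n) := (hside D).of_le (le_max_right _ _)
  have hparikh := TagAut.powBound_parikhTagFormula (wellFormed_multiAut C)
    (powBound_card_multiAut_states hQ C hn) (powBound_card_multiAut_trans hQ C hn hA hX)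
    (powBound_card_allTags hA hn hX)
  rw [← LIA.size_rename MVar.parikh] at hparikh
  exact .mono (.and hparikh
    (.and (powBound_fairFormula hA hn hX)
      (.and (powBound_consistFormula hA hn hX)
        (.and (powBound_copiesFormula hA hn hX)
          (.conj (powBound_card_diseqs hn) fun D _ =>
            .or (.ne (powBound_lenTerm (hlhs D)) (powBound_lenTerm (hrhs D)))
              (.and (powBound_misFormula hA hn D (hlhs D) (hrhs D)) (.ne .var .var)))))))
    (by decide)

end

end MultiDiseq

theorem mainTheorem7 (A : Type uA) [Fintype A] :
    ∃ p : Polynomial ℕ,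
      ∀ (X : Type uX) [Fintype X] [LinearOrder X] [Nonempty X]
        (Q : X → Type uQ) [∀ x, Fintype (Q x)] (I : Type uI) (n : ℕ)
        (C : DiseqConstraint A X Q I n),
        (C.Satisfiable ↔ (MultiDiseq.fullFormula C).Satisfiable) ∧
        (1 ≤ n → 1 ≤ C.maxSide → (∀ x, Nonempty (Q x)) →
          (MultiDiseq.formula C).size ≤ p.eval (C.maxSide * n * C.regSize)) := by
  refine ⟨(3 * Polynomial.X + Polynomial.C (Fintype.card A) + 3) ^ 36, fun X _ _ _ Q _ I n C =>
    ⟨MultiDiseq.satisfiable_iff C, fun hn hm hQ => ?_⟩⟩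
  have hstates : Fintype.card (Σ x, Q x) = C.regSize := Fintype.card_sigma
  have hvars : Fintype.card X ≤ C.regSize :=
    hstates ▸ Fintype.card_le_of_surjective Sigma.fst fun x => ⟨⟨x, (hQ x).some⟩, rfl⟩
  have hreg : 0 < C.regSize := Fintype.card_pos.trans_le hvars
  have hregSize : C.regSize ≤ C.maxSide * n * C.regSize :=
    Nat.le_mul_of_pos_left _ (Nat.mul_pos hm hn)
  have hmaxSide : C.maxSide ≤ C.maxSide * n * C.regSize :=
    (Nat.le_mul_of_pos_right _ hn).trans (Nat.le_mul_of_pos_right _ hreg)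
  have hdiseqs : n ≤ C.maxSide * n * C.regSize :=
    (Nat.le_mul_of_pos_left _ hm).trans (Nat.le_mul_of_pos_right _ hreg)
  have hsize : PowBound (3 * (C.maxSide * n * C.regSize) + Fintype.card A) 36
      (MultiDiseq.formula C).size :=
    MultiDiseq.powBound_formula (.one_of_le (by lia)) C (.one_of_le (by lia))
      (.one_of_le (by lia)) (.one_of_le (by lia)) (.one_of_le (by lia))
  simpa [PowBound] using hsize
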